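/- Let $p$ be a prime and fix an algebraic closure $\overline{\mathbb{Q}}_p$ of $\mathbb{Q}_p$ with ring of integers $\overline{\mathbb{Z}}_p$ and $G_{\mathbb{Q}_p}=\mathrm{Gal}(\overline{\mathbb{Q}}_p/\mathbb{Q}_p)$. Let $\mathcal{G}$ be a profinite group with a continuous surjection $\omega:\mathcal{G}\to\Gamma$ onto a group $\Gamma\cong\mathbb{Z}_p$ with finite kernel, and let $\mathcal{Z}\cong\mathbb{Z}_p$ be an open central subgroup of $\mathcal{G}$. Notation. For an abelian profinite group $A$ let $\Lambda(A)=\mathbb{Z}_p[[A]]$. Let $\Lambda_{\overline{\mathbb{Z}}_p}(\Gamma)=\bigcup_L \mathcal{O}_L[[\Gamma]]$, where $L$ runs through the finite extensions of $\mathbb{Q}_p$ in $\overline{\mathbb{Q}}_p$; $G_{\mathbb{Q}_p}$ acts on it coefficientwise, and for a character $\varphi:\Gamma\to\overline{\mathbb{Z}}_p^\times$ with open kernel let $Tw_\varphi$ be the endomorphism of $\Lambda_{\overline{\mathbb{Z}}_p}(\Gamma)$ with $\gamma\mapsto\varphi(\gamma)\gamma$. For a profinite group $G$ let $R(G)$ be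 the group of virtual characters of continuous finite-dimensional $\overline{\mathbb{Q}}_p$-representations of $G$ with finite image. Let $\mathrm{Hom}_{G_{\mathbb{Q}_p},R(\Gamma)}(R(\mathcal{G}),\Lambda_{\overline{\mathbb{Z}}_p}(\Gamma)^\times)$ be the group of homomorphisms $f$ with $f(\sigma\circ\rho)=\sigma(f(\rho))$ for all $\sigma\in G_{\mathbb{Q}_p}$ and $f((\varphi\circ\omega)\cdot\rho)=Tw_\varphi(f(\rho))$ for all characters $\varphi$ of $\Gamma$ with open kernel. Let $S(\mathcal{G},\mathcal{Z})$ be the set of subgroups $U$ with $\mathcal{Z}\subseteq U\subseteq\mathcal{G}$, let $U^{\mathrm{ab}}$ be the quotient of $U$ by the closure of its commutator subgroup, and let $\bigl(\prod_{U\in S(\mathcal{G},\mathcal{Z})}\Lambda(U^{\mathrm{ab}})^\times\bigr)^{\mathcal{G}}$ be the group of tuples with $x_{gUg^{-1}}=g\,x_U\,g^{-1}$ for all $g\in\mathcal{G}$ and all $U$. For a character $\chi:U\to\overline{\mathbb{Z}}_p^\times$ with open kernel let $\mathrm{Det}_{U^{\mathrm{ab}}}(\cdot)(\chi):\Lambda(U^{\mathrm{ab}})^\times\to\Lambda_{\overline{\mathbb{Z}}_p}(\Gamma)^\times$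 be induced by the ring homomorphism that extends $u\mapsto\chi(u)\,\omega(u)$. For a finite group $G$ let $\mathcal{M}_G$ be the set of pairs $(U,\phi)$ of a subgroup $U\le G$ and a homomorphism $\phi:U\to\overline{\mathbb{Z}}_p^\times$, ordered by $(U,\phi)\le(U',\phi')$ iff $U\subseteq U'$ and $\phi'|_U=\phi$, with Möbius function $\mu$ and the conjugation action of $G$. Explicit Brauer induction assigns to $\rho\in R(G)$ the element $a_G(\rho)=\sum\alpha_{(U,\phi)^G}(\rho)\,(U,\phi)^G$, the sum over the $G$-conjugacy classes $(U,\phi)^G$ in $\mathcal{M}_G$, with $$\alpha_{(U,\phi)^G}(\rho)=\frac{|U|}{|G|}\sum_{(U',\phi')\in(U,\phi)^G}\ \sum_{(U'',\phi'')\ge(U',\phi')}\mu_{(U',\phi'),(U'',\phi'')}\,\langle\phi'',\mathrm{Res}^G_{U''}\rho\rangle .$$ A tuple of integers $(n_{(U,\phi)})_{(U,\phi)\in\mathcal{M}_G}$ represents $a_G(\rho)$ if $\sum_{(U',\phi')\in(U,\phi)^G}n_{(U',\phi')}=\alpha_{(U,\phi)^G}(\rho)$ for all $(U,\phi)\in\mathcal{M}_G$.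 Lemma ($\mathrm{BrInd}$ is well-defined). For every $\tilde\rho\in R(\mathcal{G}/\mathcal{Z})$ the element $a_{\mathcal{G}/\mathcal{Z}}(\tilde\rho)$ is represented by a tuple of integers. There is exactly one homomorphism $$\mathrm{BrInd}:\Bigl(\prod_{U\in S(\mathcal{G},\mathcal{Z})}\Lambda(U^{\mathrm{ab}})^\times\Bigr)^{\mathcal{G}}\to\mathrm{Hom}_{G_{\mathbb{Q}_p},R(\Gamma)}\bigl(R(\mathcal{G}),\Lambda_{\overline{\mathbb{Z}}_p}(\Gamma)^\times\bigr)$$ such that $$\mathrm{BrInd}((x_U)_U)(\rho)=Tw_{\chi^{-1}}\Bigl(\prod_{(V,\phi)\in\mathcal{M}_{\mathcal{G}/\mathcal{Z}}}\mathrm{Det}_{\tilde V^{\mathrm{ab}}}(x_{\tilde V})(\tilde\phi)^{n_{(V,\phi)}}\Bigr)$$ for all $(x_U)_U$, all $\rho\in R(\mathcal{G})$, all characters $\chi$ of $\Gamma$ with open kernel and all $\tilde\rho\in R(\mathcal{G}/\mathcal{Z})$ such that $(\chi\circ\omega)\cdot\rho$ is the inflation of $\tilde\rho$, and all tuples of integers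 $(n_{(V,\phi)})$ that represent $a_{\mathcal{G}/\mathcal{Z}}(\tilde\rho)$. Here $\tilde V\in S(\mathcal{G},\mathcal{Z})$ is the preimage of $V$ in $\mathcal{G}$ and $\tilde\phi$ is the inflation of $\phi$ to $\tilde V$. In particular the value is independent of the choice of $\chi$ and of the representing tuple, and $\mathrm{BrInd}((x_U)_U)$ is $G_{\mathbb{Q}_p}$- and $R(\Gamma)$-invariant. -/

import Mathlib

noncomputable section

namespace BrauerIwasawa

/-! ### Completed group algebras of abelian topological groups -/

section CompletedGroupAlgebra

variable (R : Type*) [CommRing R] {S : Type*} [CommRing S]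
variable (A : Type*) [CommGroup A] [TopologicalSpace A]
variable {B : Type*} [CommGroup B] [TopologicalSpace B]

variable {A} in
/-- The projection `R[A/N] → R[A/M]` for subgroups `N ≤ M`. -/
def transition {N M : Subgroup A} (h : N ≤ M) :
    MonoidAlgebra R (A ⧸ N) →+* MonoidAlgebra R (A ⧸ M) :=
  MonoidAlgebra.mapDomainRingHom R (QuotientGroup.map N M (MonoidHom.id A) h)

/-- The completed group algebra `Λ_R(A) = R[[A]] = lim R[A/N]`, the limit over all open
subgroups `N` of `A`, realised as a subring of the product of the `R[A/N]`. -/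
def IwasawaAlgebra :
    Subring (∀ N : OpenSubgroup A, MonoidAlgebra R (A ⧸ (N : Subgroup A))) where
  carrier := {f | ∀ (N M : OpenSubgroup A) (h : (N : Subgroup A) ≤ (M : Subgroup A)),
    transition R h (f N) = f M}
  mul_mem' := fun ha hb N M h => by
    simp only [Pi.mul_apply, map_mul, ha N M h, hb N M h]
  one_mem' := fun N M h => by simp only [Pi.one_apply, map_one]
  add_mem' := fun ha hb N M h => by
    simp only [Pi.add_apply, map_add, ha N M h, hb N M h]
  zero_mem' := fun N M h => by simp only [Pi.zero_apply, map_zero]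
  neg_mem' := fun ha N M h => by simp only [Pi.neg_apply, map_neg, ha N M h]

variable {R A}

/-- The multiplicative map `a ↦ χ(a) · [π(a)]` from `A` to `S[B/M]`. -/
def twistedPoint (π : A →* B) (χ : A →* Sˣ) (M : Subgroup B) :
    A →* MonoidAlgebra S (B ⧸ M) where
  toFun a := MonoidAlgebra.single (QuotientGroup.mk' M (π a)) (χ a : S)
  map_one' := by simp [MonoidAlgebra.one_def]
  map_mul' a b := by simp [MonoidAlgebra.single_mul_single]

/-- The ring homomorphism `R[A/N] → S[B/M]`, `r·[a] ↦ f(r) χ(a) [π(a)]`, for a subgroup `N` with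
`π(N) ⊆ M` and `χ(N) = 1`. -/
def twistLevel (f : R →+* S) (π : A →* B) (χ : A →* Sˣ) (N : Subgroup A) (M : Subgroup B)
    (hπ : N ≤ M.comap π) (hχ : N ≤ χ.ker) :
    MonoidAlgebra R (A ⧸ N) →+* MonoidAlgebra S (B ⧸ M) :=
  MonoidAlgebra.liftNCRingHom (MonoidAlgebra.singleOneRingHom.comp f)
    (QuotientGroup.lift N (twistedPoint π χ M) (fun a ha => by
      have h1 : (QuotientGroup.mk' M (π a)) = 1 := (QuotientGroup.eq_one_iff _).2 (hπ ha)
      have h2 : χ a = 1 := hχ ha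
      simp only [MonoidHom.mem_ker, twistedPoint, MonoidHom.coe_mk, OneHom.coe_mk, h1, h2,
        Units.val_one, MonoidAlgebra.one_def]))
    (fun _ _ => Commute.all _ _)

theorem twistLevel_single (f : R →+* S) (π : A →* B) (χ : A →* Sˣ) (N : Subgroup A)
    (M : Subgroup B) (hπ : N ≤ M.comap π) (hχ : N ≤ χ.ker) (a : A) (r : R) :
    twistLevel f π χ N M hπ hχ (MonoidAlgebra.single (a : A ⧸ N) r) =
      MonoidAlgebra.single ((π a : B) : B ⧸ M) (f r * (χ a : S)) := by
  simp [twistLevel, twistedPoint, MonoidAlgebra.single_mul_single]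

theorem transition_twistLevel (f : R →+* S) (π : A →* B) (χ : A →* Sˣ) (N N' : Subgroup A)
    (M M' : Subgroup B) (hπ : N ≤ M.comap π) (hχ : N ≤ χ.ker) (hπ' : N' ≤ M'.comap π)
    (hχ' : N' ≤ χ.ker) (hN : N ≤ N') (hM : M ≤ M') (x : MonoidAlgebra R (A ⧸ N)) :
    transition S hM (twistLevel f π χ N M hπ hχ x) =
      twistLevel f π χ N' M' hπ' hχ' (transition R hN x) := by
  induction x using MonoidAlgebra.induction_linear with
  | zero => simp only [map_zero]
  | add x y hx hy => simp only [map_add, hx, hy]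
  | single a r =>
    obtain ⟨a, rfl⟩ := QuotientGroup.mk_surjective a
    rw [twistLevel_single]
    have h1 : transition R hN (MonoidAlgebra.single (a : A ⧸ N) r) =
        MonoidAlgebra.single (a : A ⧸ N') r := by
      simp only [transition, MonoidAlgebra.mapDomainRingHom_apply, MonoidAlgebra.mapDomain_single]
      rfl
    rw [h1, twistLevel_single]
    simp only [transition, MonoidAlgebra.mapDomainRingHom_apply, MonoidAlgebra.mapDomain_single]
    rfl

/-- The open subgroup `π⁻¹(M) ∩ ker χ`. -/
def twistSource (π : A →* B) (hπ : Continuous π) (χ : A →* Sˣ)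
    (hχ : IsOpen (χ.ker : Set A)) (M : OpenSubgroup B) : OpenSubgroup A :=
  M.comap π hπ ⊓ ⟨χ.ker, hχ⟩

theorem twistSource_le_comap (π : A →* B) (hπ : Continuous π) (χ : A →* Sˣ)
    (hχ : IsOpen (χ.ker : Set A)) (M : OpenSubgroup B) :
    (twistSource π hπ χ hχ M : Subgroup A) ≤ (M : Subgroup B).comap π := fun _ ha => And.left ha

theorem twistSource_le_ker (π : A →* B) (hπ : Continuous π) (χ : A →* Sˣ)
    (hχ : IsOpen (χ.ker : Set A)) (M : OpenSubgroup B) :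
    (twistSource π hπ χ hχ M : Subgroup A) ≤ χ.ker := fun _ ha => And.right ha

/-- The ring homomorphism `Λ_R(A) → Λ_S(B)` that extends `r·a ↦ f(r) χ(a) π(a)`, for a ring
homomorphism `f : R → S`, a continuous homomorphism `π : A → B` and a character `χ : A → Sˣ`
with open kernel. -/
def twistMap (f : R →+* S) (π : A →* B) (hπ : Continuous π) (χ : A →* Sˣ)
    (hχ : IsOpen (χ.ker : Set A)) : IwasawaAlgebra R A →+* IwasawaAlgebra S B :=
  RingHom.codRestrict
    (RingHom.pi fun M : OpenSubgroup B =>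
      (twistLevel f π χ (twistSource π hπ χ hχ M : Subgroup A) (M : Subgroup B)
        (twistSource_le_comap π hπ χ hχ M) (twistSource_le_ker π hπ χ hχ M)).comp
      ((Pi.evalRingHom _ (twistSource π hπ χ hχ M)).comp (IwasawaAlgebra R A).subtype))
    (IwasawaAlgebra S B)
    (fun x M M' h => by
      have hN : (twistSource π hπ χ hχ M : Subgroup A) ≤ (twistSource π hπ χ hχ M' : Subgroup A) :=
        fun a ha => And.intro (h (And.left ha)) (And.right ha)
      have e := x.2 _ _ hN
      change transition S h (twistLevel f π χ _ _ (twistSource_le_comap π hπ χ hχ M)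
          (twistSource_le_ker π hπ χ hχ M) (x.1 (twistSource π hπ χ hχ M))) =
        twistLevel f π χ _ _ (twistSource_le_comap π hπ χ hχ M')
          (twistSource_le_ker π hπ χ hχ M') (x.1 (twistSource π hπ χ hχ M'))
      rw [← e]
      exact transition_twistLevel ..)

/-- The subring `B[A]` of `S[A]`, for a subring `B` of `S`. -/
def coeffSubring (B : Subring S) (A : Type*) [CommGroup A] : Subring (MonoidAlgebra S A) where
  carrier := {x | ∀ a, x.coeff a ∈ B}
  mul_mem' := fun {x y} hx hy a => by
    classical
    rw [MonoidAlgebra.coeff_mul]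
    refine sum_mem fun i _ => sum_mem fun j _ => ?_
    dsimp only
    split_ifs
    · exact B.mul_mem (hx _) (hy _)
    · exact B.zero_mem
  one_mem' := fun a => by
    classical
    rw [MonoidAlgebra.one_def, MonoidAlgebra.coeff_single, Finsupp.single_apply]
    split_ifs
    · exact B.one_mem
    · exact B.zero_mem
  add_mem' := fun hx hy a => by
    simpa using B.add_mem (hx a) (hy a)
  zero_mem' := fun a => by simp
  neg_mem' := fun hx a => by simpa using B.neg_mem (hx a)

theorem twistMap_mem_coeffSubring (f : R →+* S) (π : A →* B) (hπ : Continuous π) (χ : A →* Sˣ)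
    (hχ : IsOpen (χ.ker : Set A)) (T : Subring S) (hT : ∀ a, (χ a : S) ∈ T)
    (x : IwasawaAlgebra R A) (hx : ∀ N a, f ((x.1 N).coeff a) ∈ T) (M : OpenSubgroup B) :
    (twistMap f π hπ χ hχ x).1 M ∈ coeffSubring T (B ⧸ (M : Subgroup B)) := by
  change twistLevel f π χ (twistSource π hπ χ hχ M : Subgroup A) (M : Subgroup B)
    (twistSource_le_comap π hπ χ hχ M) (twistSource_le_ker π hπ χ hχ M)
    (x.1 (twistSource π hπ χ hχ M)) ∈ _
  rw [← MonoidAlgebra.sum_coeff_single (x.1 (twistSource π hπ χ hχ M)), Finsupp.sum, map_sum]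
  refine sum_mem fun a _ => ?_
  obtain ⟨a, rfl⟩ := QuotientGroup.mk_surjective a
  rw [twistLevel_single]
  intro b
  classical
  rw [MonoidAlgebra.coeff_single, Finsupp.single_apply]
  split_ifs
  · exact T.mul_mem (hx _ _) (hT a)
  · exact T.zero_mem

end CompletedGroupAlgebra

/-! ### The ring of integers of `ℚ̄_p` and characters with finite image -/

section Characters

variable (p : ℕ) [Fact p.Prime]

/-- The ring of integers of the algebraic closure `ℚ̄_p` of `ℚ_p`. -/
abbrev Zbar : Type := integralClosure ℤ_[p] (PadicAlgCl p)

/-- The restriction of `σ ∈ Gal(ℚ̄_p/ℚ_p)` to the ring of integers of `ℚ̄_p`. -/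
def galZbar (σ : PadicAlgCl p ≃ₐ[ℚ_[p]] PadicAlgCl p) : Zbar p →+* Zbar p :=
  ((σ.restrictScalars ℤ_[p]).mapIntegralClosure : Zbar p ≃ₐ[ℤ_[p]] Zbar p)

theorem coe_galZbar (σ : PadicAlgCl p ≃ₐ[ℚ_[p]] PadicAlgCl p) (x : Zbar p) :
    (galZbar p σ x : PadicAlgCl p) = σ x := rfl

variable (A : Type*) [Group A] [TopologicalSpace A]

/-- The group of one-dimensional characters `A → ℤ̄_pˣ` with open kernel. For compact `A` these
are the continuous one-dimensional characters with finite image. -/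
def FinChar [IsTopologicalGroup A] : Subgroup (A →* (Zbar p)ˣ) where
  carrier := {χ | IsOpen (χ.ker : Set A)}
  mul_mem' := fun {χ ψ} hχ hψ => by
    refine Subgroup.isOpen_mono (H₁ := χ.ker ⊓ ψ.ker) ?_ (IsOpen.inter hχ hψ)
    intro a ha
    have h1 : χ a = 1 := ha.1
    have h2 : ψ a = 1 := ha.2
    simp [MonoidHom.mem_ker, h1, h2]
  one_mem' := by simp
  inv_mem' := fun {χ} hχ => by
    have : (χ⁻¹).ker = χ.ker := by ext; simp [MonoidHom.mem_ker]
    simpa [this] using hχ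

variable {p A}

theorem finite_range_of_isOpen_ker [IsTopologicalGroup A] [CompactSpace A] (χ : A →* (Zbar p)ˣ)
    (hχ : IsOpen (χ.ker : Set A)) : (Set.range χ).Finite := by
  have : Finite (A ⧸ χ.ker) := Subgroup.quotient_finite_of_isOpen _ hχ
  have h2 : Finite χ.range := Finite.of_equiv _ (QuotientGroup.quotientKerEquivRange χ).toEquiv
  simpa using Set.toFinite (χ.range : Set (Zbar p)ˣ)

/-- The field generated over `ℚ_p` by the values of `χ`. -/
def valueField (χ : A →* (Zbar p)ˣ) : IntermediateField ℚ_[p] (PadicAlgCl p) :=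
  IntermediateField.adjoin ℚ_[p] (Set.range fun a => ((χ a : Zbar p) : PadicAlgCl p))

theorem finiteDimensional_valueField [IsTopologicalGroup A] [CompactSpace A]
    (χ : A →* (Zbar p)ˣ) (hχ : IsOpen (χ.ker : Set A)) :
    FiniteDimensional ℚ_[p] (valueField χ) := by
  have h := finite_range_of_isOpen_ker χ hχ
  have : Finite (Set.range fun a => ((χ a : Zbar p) : PadicAlgCl p)) := by
    refine (Set.Finite.subset (h.image fun u : (Zbar p)ˣ => ((u : Zbar p) : PadicAlgCl p)) ?_).to_subtype
    rintro _ ⟨a, rfl⟩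
    exact ⟨χ a, ⟨a, rfl⟩, rfl⟩
  exact IntermediateField.finiteDimensional_adjoin
    fun x _ => (Algebra.IsAlgebraic.isAlgebraic x).isIntegral

theorem mem_valueField (χ : A →* (Zbar p)ˣ) (a : A) :
    ((χ a : Zbar p) : PadicAlgCl p) ∈ valueField χ :=
  IntermediateField.subset_adjoin _ _ ⟨a, rfl⟩

/-- The pull-back of a character with open kernel along a continuous homomorphism. -/
def FinChar.infl [IsTopologicalGroup A] {B : Type*} [Group B] [TopologicalSpace B]
    [IsTopologicalGroup B] (ω : A →* B) (hω : Continuous ω) (χ : FinChar p B) : FinChar p A :=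
  ⟨χ.1.comp ω, by
    have h : (χ.1.comp ω).ker = χ.1.ker.comap ω := by ext; simp [MonoidHom.mem_ker]
    change IsOpen ((χ.1.comp ω).ker : Set A)
    rw [h]
    exact χ.2.preimage hω⟩

end Characters

/-! ### The Iwasawa algebra with coefficients in the ring of integers of `ℚ̄_p` -/

section LambdaZbar

variable (p : ℕ) [Fact p.Prime]

/-- The elements of the ring of integers of `ℚ̄_p` that lie in `L`. -/
def integersIn (L : IntermediateField ℚ_[p] (PadicAlgCl p)) : Subring (Zbar p) :=
  L.toSubring.comap (integralClosure ℤ_[p] (PadicAlgCl p)).val.toRingHom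

theorem mem_integersIn {L : IntermediateField ℚ_[p] (PadicAlgCl p)} {x : Zbar p} :
    x ∈ integersIn p L ↔ (x : PadicAlgCl p) ∈ L := Iff.rfl

theorem integersIn_mono {L L' : IntermediateField ℚ_[p] (PadicAlgCl p)} (h : L ≤ L') :
    integersIn p L ≤ integersIn p L' := fun _ hx => h hx

variable (Γ : Type*) [CommGroup Γ] [TopologicalSpace Γ]

/-- `Λ_{ℤ̄_p}(Γ) = ⋃_L Λ_{O_L}(Γ) = ℤ̄_p ⊗ Λ(Γ)`, where `L` runs through the finite extensions of
`ℚ_p` in `ℚ̄_p`: the elements of `ℤ̄_p[[Γ]]` all of whose coefficients lie in one such `L`. -/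
def LambdaZbar : Subring (IwasawaAlgebra (Zbar p) Γ) where
  carrier := {x | ∃ L : IntermediateField ℚ_[p] (PadicAlgCl p), FiniteDimensional ℚ_[p] L ∧
    ∀ N : OpenSubgroup Γ, x.1 N ∈ coeffSubring (integersIn p L) (Γ ⧸ (N : Subgroup Γ))}
  mul_mem' := by
    rintro x y ⟨L, hL, hx⟩ ⟨L', hL', hy⟩
    exact ⟨L ⊔ L', inferInstance, fun N => Subring.mul_mem _
      (fun a => integersIn_mono p le_sup_left (hx N a))
      (fun a => integersIn_mono p le_sup_right (hy N a))⟩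
  one_mem' := ⟨⊥, inferInstance, fun N => Subring.one_mem _⟩
  add_mem' := by
    rintro x y ⟨L, hL, hx⟩ ⟨L', hL', hy⟩
    exact ⟨L ⊔ L', inferInstance, fun N => Subring.add_mem _
      (fun a => integersIn_mono p le_sup_left (hx N a))
      (fun a => integersIn_mono p le_sup_right (hy N a))⟩
  zero_mem' := ⟨⊥, inferInstance, fun N => Subring.zero_mem _⟩
  neg_mem' := by
    rintro x ⟨L, hL, hx⟩
    exact ⟨L, hL, fun N => Subring.neg_mem _ (hx N)⟩

variable {p Γ}

/-- The coefficientwise action of `σ ∈ Gal(ℚ̄_p/ℚ_p)` on `Λ_{ℤ̄_p}(Γ)`. -/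
def galLambda (σ : PadicAlgCl p ≃ₐ[ℚ_[p]] PadicAlgCl p) : LambdaZbar p Γ →+* LambdaZbar p Γ :=
  ((twistMap (galZbar p σ) (MonoidHom.id Γ) continuous_id 1 (by simp)).comp
    (LambdaZbar p Γ).subtype).codRestrict (LambdaZbar p Γ) (by
      rintro ⟨x, L, hL, hx⟩
      refine ⟨L.map (σ : PadicAlgCl p →ₐ[ℚ_[p]] PadicAlgCl p), inferInstance, fun M => ?_⟩
      refine twistMap_mem_coeffSubring _ _ _ _ _ _ (fun a => ?_) x (fun N a => ?_) M
      · exact Subring.one_mem _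
      · exact ⟨_, hx N a, rfl⟩)

/-- The twist `Tw_φ`, the ring endomorphism of `Λ_{ℤ̄_p}(Γ)` with `γ ↦ φ(γ) γ`, for a character
`φ` of `Γ` with finite image. -/
def Tw [IsTopologicalGroup Γ] [CompactSpace Γ] (φ : FinChar p Γ) :
    LambdaZbar p Γ →+* LambdaZbar p Γ :=
  ((twistMap (RingHom.id (Zbar p)) (MonoidHom.id Γ) continuous_id φ.1 φ.2).comp
    (LambdaZbar p Γ).subtype).codRestrict (LambdaZbar p Γ) (by
      rintro ⟨x, L, hL, hx⟩
      have := finiteDimensional_valueField φ.1 φ.2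
      refine ⟨L ⊔ valueField φ.1, inferInstance, fun M => ?_⟩
      refine twistMap_mem_coeffSubring _ _ _ _ _ _ (fun a => ?_) x (fun N a => ?_) M
      · exact integersIn_mono p le_sup_right (mem_valueField φ.1 a)
      · exact integersIn_mono p le_sup_left (hx N a))

end LambdaZbar

/-! ### The maps `Det` for abelianized groups -/

section Det

variable {p : ℕ} [Fact p.Prime]
variable {U : Type*} [Group U] [TopologicalSpace U] [IsTopologicalGroup U]

theorem closure_commutator_le_ker {C : Type*} [CommGroup C] (f : U →* C)
    (hf : IsClosed (f.ker : Set U)) : (commutator U).topologicalClosure ≤ f.ker :=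
  Subgroup.topologicalClosure_minimal _ (Abelianization.commutator_subset_ker f) hf

/-- The map induced on `U^ab` by a homomorphism with closed kernel to an abelian group. -/
def liftAb {C : Type*} [CommGroup C] (f : U →* C) (hf : IsClosed (f.ker : Set U)) :
    TopologicalAbelianization U →* C :=
  QuotientGroup.lift _ f (closure_commutator_le_ker f hf)

theorem continuous_liftAb {C : Type*} [CommGroup C] [TopologicalSpace C] (f : U →* C)
    (hf : IsClosed (f.ker : Set U)) (hc : Continuous f) : Continuous (liftAb f hf) :=
  hc.quotient_lift _

theorem isOpen_ker_liftAb {C : Type*} [CommGroup C] (f : U →* C) (hf : IsClosed (f.ker : Set U))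
    (ho : IsOpen (f.ker : Set U)) : IsOpen ((liftAb f hf).ker : Set (TopologicalAbelianization U)) := by
  rw [← (QuotientGroup.isQuotientMap_mk (N := (commutator U).topologicalClosure)).isOpen_preimage]
  exact ho

variable {Γ : Type*} [CommGroup Γ] [TopologicalSpace Γ] [T1Space Γ]

/-- The evaluation `x ↦ Det_{U^ab}(x)(χ)` at a one-dimensional character `χ` of `U` with finite
image: the ring homomorphism `Λ(U^ab) → Λ_{ℤ̄_p}(Γ)` that extends `u ↦ χ(u) π(u)`, where
`π : U → Γ` is the given projection. It takes values in `Λ_{ℤ̄_p}(π(U)) ⊆ Λ_{ℤ̄_p}(Γ)`. -/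
def det [CompactSpace U] (π : U →* Γ) (hπ : Continuous π) (χ : FinChar p U) :
    IwasawaAlgebra ℤ_[p] (TopologicalAbelianization U) →+* LambdaZbar p Γ :=
  (twistMap (algebraMap ℤ_[p] (Zbar p))
    (liftAb π (isClosed_singleton.preimage hπ))
    (continuous_liftAb π (isClosed_singleton.preimage hπ) hπ)
    (liftAb χ.1 (Subgroup.isClosed_of_isOpen _ χ.2))
    (isOpen_ker_liftAb _ _ χ.2)).codRestrict (LambdaZbar p Γ) (by
      intro x
      refine ⟨valueField χ.1, finiteDimensional_valueField χ.1 χ.2, fun M => ?_⟩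
      refine twistMap_mem_coeffSubring _ _ _ _ _ _ (fun a => ?_) x (fun N a => ?_) M
      · obtain ⟨a, rfl⟩ := QuotientGroup.mk_surjective a
        exact mem_valueField χ.1 a
      · exact (valueField χ.1).algebraMap_mem _)

end Det

/-! ### Virtual characters -/

section VirtualCharacters

variable (p : ℕ) [Fact p.Prime] (G : Type*) [Group G] [TopologicalSpace G]

/-- `f` is the character of a representation `G → GL_n(ℚ̄_p)` with open kernel. -/
def IsCharacter (f : G → PadicAlgCl p) : Prop :=
  ∃ (n : ℕ) (r : G →* Matrix (Fin n) (Fin n) (PadicAlgCl p)),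
    IsOpen (r.ker : Set G) ∧ ∀ g, f g = (r g).trace

/-- The group `R(G)` of virtual characters of `G`. -/
def VChar : AddSubgroup (G → PadicAlgCl p) :=
  AddSubgroup.closure {f | IsCharacter p G f}

variable {p G}

theorem IsCharacter.gal {f : G → PadicAlgCl p} (hf : IsCharacter p G f)
    (σ : PadicAlgCl p ≃ₐ[ℚ_[p]] PadicAlgCl p) : IsCharacter p G (fun g => σ (f g)) := by
  obtain ⟨n, r, hr, hfr⟩ := hf
  let s : Matrix (Fin n) (Fin n) (PadicAlgCl p) →+* Matrix (Fin n) (Fin n) (PadicAlgCl p) :=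
    (σ : PadicAlgCl p →+* PadicAlgCl p).mapMatrix
  have hs : Function.Injective s := Matrix.map_injective σ.injective
  refine ⟨n, s.toMonoidHom.comp r, ?_, fun g => ?_⟩
  · have h : (s.toMonoidHom.comp r).ker = r.ker := by
      ext g
      simp only [MonoidHom.mem_ker, MonoidHom.comp_apply]
      exact map_eq_one_iff s hs
    rwa [h]
  · change σ (f g) = _
    rw [hfr g]
    exact AddMonoidHom.map_trace (σ : PadicAlgCl p →+* PadicAlgCl p) (r g)

theorem IsCharacter.twist [IsTopologicalGroup G] {f : G → PadicAlgCl p} (hf : IsCharacter p G f)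
    (χ : FinChar p G) :
    IsCharacter p G (fun g => ((χ.1 g : Zbar p) : PadicAlgCl p) * f g) := by
  obtain ⟨n, r, hr, hfr⟩ := hf
  refine ⟨n, ⟨⟨fun g => ((χ.1 g : Zbar p) : PadicAlgCl p) • r g, by simp⟩,
    fun a b => by simp [smul_smul, mul_comm]⟩, ?_, fun g => ?_⟩
  · refine Subgroup.isOpen_mono (H₁ := χ.1.ker ⊓ r.ker) ?_ (IsOpen.inter χ.2 hr)
    intro a ha
    have h1 : χ.1 a = 1 := ha.1
    have h2 : r a = 1 := ha.2
    simp [MonoidHom.mem_ker, h1, h2]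
  · simp [hfr g]

/-- The action of `σ ∈ Gal(ℚ̄_p/ℚ_p)` on `R(G)`, `ρ ↦ σ ∘ ρ`. -/
def VChar.gal (σ : PadicAlgCl p ≃ₐ[ℚ_[p]] PadicAlgCl p) (ρ : VChar p G) : VChar p G :=
  ⟨fun g => σ (ρ.1 g), by
    obtain ⟨ρ, hρ⟩ := ρ
    induction hρ using AddSubgroup.closure_induction with
    | mem x hx => exact AddSubgroup.subset_closure (IsCharacter.gal hx σ)
    | zero => convert (VChar p G).zero_mem using 1; ext g; simp
    | add x y _ _ h1 h2 => convert (VChar p G).add_mem h1 h2 using 1; ext g; simp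
    | neg x _ h => convert (VChar p G).neg_mem h using 1; ext g; simp⟩

/-- The multiplication of virtual characters by a one-dimensional character. -/
def VChar.twist [IsTopologicalGroup G] (χ : FinChar p G) (ρ : VChar p G) : VChar p G :=
  ⟨fun g => ((χ.1 g : Zbar p) : PadicAlgCl p) * ρ.1 g, by
    obtain ⟨ρ, hρ⟩ := ρ
    induction hρ using AddSubgroup.closure_induction with
    | mem x hx => exact AddSubgroup.subset_closure (IsCharacter.twist hx χ)
    | zero => convert (VChar p G).zero_mem using 1; ext g; simp
    | add x y _ _ h1 h2 => convert (VChar p G).add_mem h1 h2 using 1; ext g; simp [mul_add]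
    | neg x _ h => convert (VChar p G).neg_mem h using 1; ext g; simp⟩

end VirtualCharacters

/-! ### Explicit Brauer induction for finite groups -/

section Brauer

variable (p : ℕ) [Fact p.Prime] (G : Type*) [Group G]

/-- A pair `(U, φ)` of a subgroup `U` of `G` and a one-dimensional character `φ : U → ℤ̄_pˣ`. -/
@[ext]
structure MonPair where
  U : Subgroup G
  φ : U →* (Zbar p)ˣ

variable {p G}

namespace MonPair

/-- `(U, φ) ≤ (U', φ')` if `U ⊆ U'` and `φ'` restricts to `φ`. -/
instance : PartialOrder (MonPair p G) where
  le P Q := ∃ h : P.U ≤ Q.U, ∀ u : P.U, Q.φ (Subgroup.inclusion h u) = P.φ u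
  le_refl P := ⟨le_rfl, fun _ => rfl⟩
  le_trans P Q T := by
    rintro ⟨h1, h2⟩ ⟨h3, h4⟩
    exact ⟨h1.trans h3, fun u => (h4 (Subgroup.inclusion h1 u)).trans (h2 u)⟩
  le_antisymm P Q := by
    rintro ⟨h1, h2⟩ ⟨h3, _⟩
    obtain ⟨U, φ⟩ := P
    obtain ⟨V, ψ⟩ := Q
    obtain rfl : U = V := le_antisymm h1 h3
    congr 1
    ext1 u
    exact (h2 u).symm

/-- The conjugate `(gUg⁻¹, φ(g⁻¹ · g))` of `(U, φ)`. -/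
def conj (g : G) (P : MonPair p G) : MonPair p G where
  U := P.U.map (MulAut.conj g).toMonoidHom
  φ := P.φ.comp ((MulAut.conj g).subgroupMap P.U).symm.toMonoidHom

instance [Finite G] : Finite (MonPair p G) := by
  classical
  have hn : Nat.card G ≠ 0 := Nat.card_pos.ne'
  have : NeZero (Nat.card G) := ⟨hn⟩
  have key : ∀ U : Subgroup G, Finite (U →* (Zbar p)ˣ) := fun U => by
    let F : (U →* (Zbar p)ˣ) → U → rootsOfUnity (Nat.card G) (Zbar p) := fun φ u =>
      ⟨φ u, by
        rw [mem_rootsOfUnity, ← map_pow]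
        have : u ^ Nat.card G = 1 := Subtype.ext (by simp)
        rw [this, map_one]⟩
    refine Finite.of_injective F fun φ ψ h => ?_
    ext1 u
    exact congrArg Subtype.val (congrFun h u)
  refine Finite.of_injective
    (β := Σ U : Subgroup G, (U →* (Zbar p)ˣ)) (fun P => ⟨P.U, P.φ⟩) ?_
  rintro ⟨U, φ⟩ ⟨V, ψ⟩ h
  simp only [Sigma.mk.injEq] at h
  obtain ⟨rfl, h⟩ := h
  rw [eq_of_heq h]

instance [Finite G] : Fintype (MonPair p G) := Fintype.ofFinite _

open Classical in
instance [Finite G] : LocallyFiniteOrder (MonPair p G) := Fintype.toLocallyFiniteOrder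

/-- The Schur inner product `⟨φ, Res_U ρ⟩ = |U|⁻¹ ∑_{u ∈ U} φ(u⁻¹) ρ(u)`. -/
def inner (P : MonPair p G) [Finite G] (ρ : G → PadicAlgCl p) : PadicAlgCl p :=
  (Nat.card P.U : PadicAlgCl p)⁻¹ *
    ∑ᶠ u : P.U, ((P.φ u⁻¹ : Zbar p) : PadicAlgCl p) * ρ u

end MonPair

open Classical in
/-- The coefficient of the conjugacy class of `P = (U, φ)` in `a_G(ρ)`:
`α_P(ρ) = |U|/|G| ∑_{P' ∼ P} ∑_{P'' ≥ P'} μ(P', P'') ⟨φ'', Res ρ⟩`, where `μ` is the Möbius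
function of the poset of all pairs. -/
def brauerCoeff [Finite G] (ρ : G → PadicAlgCl p) (P : MonPair p G) : PadicAlgCl p :=
  (Nat.card P.U : PadicAlgCl p) / (Nat.card G : PadicAlgCl p) *
    ∑ P' : MonPair p G with ∃ g, P' = P.conj g,
      ∑ P'' : MonPair p G with P' ≤ P'',
        (IncidenceAlgebra.mu ℤ P' P'' : PadicAlgCl p) * P''.inner ρ

open Classical in
/-- The tuple `c` of integers `c (U, φ)` represents `a_G(ρ)`: its image in the free abelian group
on the conjugacy classes of pairs is `∑ α_P(ρ) · [P]`. -/
def Represents [Finite G] (c : MonPair p G →₀ ℤ) (ρ : G → PadicAlgCl p) : Prop :=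
  ∀ P : MonPair p G,
    ((∑ P' : MonPair p G with ∃ g, P' = P.conj g, c P' : ℤ) : PadicAlgCl p) = brauerCoeff ρ P

end Brauer

/-! ### Invariant tuples, the Hom-description and the defining product of `BrInd` -/

section Main

variable (p : ℕ) [Fact p.Prime]
variable {𝒢 : Type*} [Group 𝒢] [TopologicalSpace 𝒢] [IsTopologicalGroup 𝒢]
variable {Γ : Type*} [CommGroup Γ] [TopologicalSpace Γ] [IsTopologicalGroup Γ] [CompactSpace Γ]

/-- The set `S(𝒢, 𝒵)` of subgroups `𝒵 ≤ U ≤ 𝒢`. -/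
abbrev SubgroupsOver (𝒵 : OpenNormalSubgroup 𝒢) : Type _ :=
  {U : Subgroup 𝒢 // 𝒵.toSubgroup ≤ U}

variable {𝒵 : OpenNormalSubgroup 𝒢}

theorem SubgroupsOver.isOpen (U : SubgroupsOver 𝒵) : IsOpen (U.1 : Set 𝒢) :=
  Subgroup.isOpen_mono U.2 𝒵.isOpen'

instance [CompactSpace 𝒢] (U : SubgroupsOver 𝒵) : CompactSpace U.1 :=
  isCompact_iff_compactSpace.1 (Subgroup.isClosed_of_isOpen _ U.isOpen).isCompact

/-- The conjugate `gUg⁻¹`. -/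
def SubgroupsOver.conj (g : 𝒢) (U : SubgroupsOver 𝒵) : SubgroupsOver 𝒵 :=
  ⟨U.1.map (MulAut.conj g).toMonoidHom, fun z hz =>
    ⟨g⁻¹ * z * g, U.2 (by simpa using 𝒵.isNormal'.conj_mem z hz g⁻¹), by simp [mul_assoc]⟩⟩

/-- The map `U → gUg⁻¹`, `u ↦ gug⁻¹`. -/
def conjHom (g : 𝒢) (U : SubgroupsOver 𝒵) : U.1 →* (U.conj g).1 :=
  (MulAut.conj g).toMonoidHom.subgroupMap U.1

theorem continuous_conjHom (g : 𝒢) (U : SubgroupsOver 𝒵) : Continuous (conjHom g U) := by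
  refine Continuous.subtype_mk (f := fun u : U.1 => g * (u : 𝒢) * g⁻¹) ?_ _
  fun_prop

theorem closure_commutator_le_comap (g : 𝒢) (U : SubgroupsOver 𝒵) :
    (commutator U.1).topologicalClosure ≤
      ((commutator (U.conj g).1).topologicalClosure).comap (conjHom g U) := by
  refine Subgroup.topologicalClosure_minimal _ ?_
    ((Subgroup.isClosed_topologicalClosure _).preimage (continuous_conjHom g U))
  rw [← Subgroup.map_le_iff_le_comap, commutator_def, Subgroup.map_commutator]
  exact (Subgroup.commutator_mono le_top le_top).trans (Subgroup.le_topologicalClosure _)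

/-- The map `U^ab → (gUg⁻¹)^ab` induced by `u ↦ gug⁻¹`. -/
def conjAb (g : 𝒢) (U : SubgroupsOver 𝒵) :
    TopologicalAbelianization U.1 →* TopologicalAbelianization (U.conj g).1 :=
  QuotientGroup.map _ _ (conjHom g U) (closure_commutator_le_comap g U)

theorem continuous_conjAb (g : 𝒢) (U : SubgroupsOver 𝒵) : Continuous (conjAb g U) :=
  Continuous.quotient_lift (QuotientGroup.continuous_mk.comp (continuous_conjHom g U)) _

/-- The map `Λ(U^ab) → Λ((gUg⁻¹)^ab)`, `x ↦ g x g⁻¹`. -/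
def conjLambda (g : 𝒢) (U : SubgroupsOver 𝒵) :
    IwasawaAlgebra ℤ_[p] (TopologicalAbelianization U.1) →+*
      IwasawaAlgebra ℤ_[p] (TopologicalAbelianization (U.conj g).1) :=
  twistMap (RingHom.id ℤ_[p]) (conjAb g U) (continuous_conjAb g U) 1 (by simp)

variable (𝒵) in
/-- The group `(∏_{U ∈ S(𝒢, 𝒵)} Λ(U^ab)ˣ)^𝒢` of tuples with `x_{gUg⁻¹} = g x_U g⁻¹`. -/
def InvTuples :
    Subgroup (∀ U : SubgroupsOver 𝒵, (IwasawaAlgebra ℤ_[p] (TopologicalAbelianization U.1))ˣ) where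
  carrier := {x | ∀ (g : 𝒢) (U : SubgroupsOver 𝒵),
    Units.map (conjLambda p g U).toMonoidHom (x U) = x (U.conj g)}
  mul_mem' := fun hx hy g U => by simp only [Pi.mul_apply, map_mul, hx g U, hy g U]
  one_mem' := fun g U => by simp only [Pi.one_apply, map_one]
  inv_mem' := fun hx g U => by simp only [Pi.inv_apply, map_inv, hx g U]

/-- The group `Hom_{G_{ℚ_p}, R(Γ)}(R(𝒢), Λ_{ℤ̄_p}(Γ)ˣ)` of the homomorphisms `f` with
`f(σρ) = σ(f(ρ))` for `σ ∈ G_{ℚ_p}` and `f(φρ) = Tw_φ(f(ρ))` for characters `φ` of `Γ` with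
finite image, inflated to `𝒢` along `ω : 𝒢 → Γ`. -/
def HomDescription (ω : 𝒢 →* Γ) (hω : Continuous ω) :
    Subgroup (Multiplicative (VChar p 𝒢) →* (LambdaZbar p Γ)ˣ) where
  carrier := {f |
    (∀ (σ : PadicAlgCl p ≃ₐ[ℚ_[p]] PadicAlgCl p) (ρ : VChar p 𝒢),
      f (Multiplicative.ofAdd (VChar.gal σ ρ)) =
        Units.map (galLambda σ).toMonoidHom (f (Multiplicative.ofAdd ρ))) ∧
    (∀ (φ : FinChar p Γ) (ρ : VChar p 𝒢),
      f (Multiplicative.ofAdd (VChar.twist (FinChar.infl ω hω φ) ρ)) =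
        Units.map (Tw φ).toMonoidHom (f (Multiplicative.ofAdd ρ)))}
  mul_mem' := fun hf hg => ⟨fun σ ρ => by simp only [MonoidHom.mul_apply, hf.1, hg.1, map_mul],
    fun φ ρ => by simp only [MonoidHom.mul_apply, hf.2, hg.2, map_mul]⟩
  one_mem' := ⟨fun σ ρ => by simp only [MonoidHom.one_apply, map_one],
    fun φ ρ => by simp only [MonoidHom.one_apply, map_one]⟩
  inv_mem' := fun hf => ⟨fun σ ρ => by simp only [MonoidHom.inv_apply, hf.1, map_inv],
    fun φ ρ => by simp only [MonoidHom.inv_apply, hf.2, map_inv]⟩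

variable {p}

/-- The preimage in `𝒢` of the subgroup of a pair of `𝒢/𝒵`. -/
def MonPair.preimage (P : MonPair p (𝒢 ⧸ 𝒵.toSubgroup)) : SubgroupsOver 𝒵 :=
  ⟨P.U.comap (QuotientGroup.mk' 𝒵.toSubgroup), fun z hz => by
    have h : QuotientGroup.mk' 𝒵.toSubgroup z = 1 := (QuotientGroup.eq_one_iff _).2 hz
    simp only [Subgroup.mem_comap, h, P.U.one_mem]⟩

/-- The inflation of the character of a pair of `𝒢/𝒵` to the preimage in `𝒢`. -/
def MonPair.inflChar (P : MonPair p (𝒢 ⧸ 𝒵.toSubgroup)) : FinChar p P.preimage.1 :=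
  ⟨P.φ.comp ((QuotientGroup.mk' 𝒵.toSubgroup).subgroupComap P.U), by
    refine Subgroup.isOpen_mono (H₁ := 𝒵.toSubgroup.subgroupOf P.preimage.1) ?_
      (𝒵.isOpen'.preimage continuous_subtype_val)
    intro u hu
    have h : (QuotientGroup.mk' 𝒵.toSubgroup).subgroupComap P.U u = 1 :=
      Subtype.ext ((QuotientGroup.eq_one_iff _).2 hu)
    change P.φ ((QuotientGroup.mk' 𝒵.toSubgroup).subgroupComap P.U u) = 1
    rw [h, map_one]⟩

/-- The product `∏_{(U, χ_U)} Det_{U^ab}(x_U)(χ_U)^{n_U}` over the pairs of `𝒢/𝒵`, for a tuple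
`c` of integers. -/
def brProduct [CompactSpace 𝒢] [T1Space Γ] (ω : 𝒢 →* Γ) (hω : Continuous ω)
    (x : ∀ U : SubgroupsOver 𝒵, (IwasawaAlgebra ℤ_[p] (TopologicalAbelianization U.1))ˣ)
    (c : MonPair p (𝒢 ⧸ 𝒵.toSubgroup) →₀ ℤ) : (LambdaZbar p Γ)ˣ :=
  c.prod fun P n =>
    Units.map (det (ω.comp P.preimage.1.subtype) (hω.comp continuous_subtype_val)
      P.inflChar).toMonoidHom (x P.preimage) ^ n

end Main

end BrauerIwasawa

end

/-! ### Reduction of a representation to a finite field -/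

noncomputable section

namespace BrauerIwasawa

open Module

section Reduction

/-! Two things need proof: the coefficients of explicit Brauer induction are integers, and the
product formula on twisted inflations from `𝒢/𝒵` extends consistently to all of `R(𝒢)`.

Integrality. Write `G = 𝒢/𝒵`, `P = (U, φ)`, and `t = |Stab(P)|/|U|`. Conjugate pairs have equal
Möbius sums, so `t · α_P(ρ) = ∑ μ(P,R) ⟨φ_R, ρ⟩` over `R ≥ P` (`brauerCoeff_eq_of_card`), and `t`
has to divide the right side. By additivity `ρ` may be the character of a representation, which is
reduced to a finite field `k` with `q` elements without changing the multiplicities of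
one-dimensional characters of subgroups (`exists_reduction`). Each nonzero `v ∈ kⁿ` has a largest
pair `Q v` with `v` in its eigenspace: the stabilizer of the line of `v` with its action on the
line. Counting eigenvectors and Möbius inversion give `#{v | Q v = P} = ∑ μ(P,R)(q^{d_R} - 1)`,
where `d_R` is the multiplicity of `R`. On this set `Stab(P) × kˣ` acts with all stabilizers of
order `|U|`, so `t(q - 1)` divides its size. Cancelling `q - 1` shows that `t` divides `∑ μ(P,R)(1 +
q + ⋯ + q^{d_R - 1})`. As `t ∣ |G| ∣ q - 1`, this is congruent to `∑ μ(P,R) d_R` modulo `t`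
(`dvd_sum_mu_mul_finrank`).

The formula on `R(𝒢/𝒵)`. For an invariant tuple, conjugate pairs give equal factors, so the product
sees only the class sums of the exponents (`prod_zpow_eq_of_represents`). Twisting and the Galois
action are automorphisms of the poset of pairs and carry representing tuples to representing tuples;
the matching change of each factor comes from the composition rule `twistMap_twistMap`.

The extension to `R(𝒢)`. The finite kernel of `ω` meets the torsion-free `𝒵` trivially, so a
finite-order character of `𝒵` with open kernel extends to `Γ`. Decomposing a representation under
the central `𝒵` and untwisting each joint eigenspace shows that twisted inflations generate `R(𝒢)`.
Linear independence of characters of `𝒵` makes `R(𝒢)` a direct sum of copies of `R(𝒢/𝒵)`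
(`sumTwistInflEquiv`). Twist equivariance then makes the formula independent of the chosen twist
(`exists_extend_twistInfl`), and generation gives uniqueness. -/

theorem isJacobsonRing_int : IsJacobsonRing ℤ := by
  refine isJacobsonRing_iff_prime_eq.2 fun P hP => ?_
  by_cases h0 : P = ⊥
  · subst h0
    refine eq_bot_iff.2 fun x hx => ?_
    -- For `x` in the Jacobson radical `2x² + 1` is a unit, hence `±1`, which forces `x = 0`.
    have h1 := Ideal.mem_jacobson_bot.1 hx (2 * x)
    rw [Int.isUnit_iff] at h1
    rw [Ideal.mem_bot]
    rcases h1 with h1 | h1 <;> nlinarith [sq_nonneg x]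
  · have := hP.isMaximal h0
    exact Ideal.jacobson_eq_self_of_isMaximal

/-- A finite subset of a field of characteristic zero lies in a subring with a homomorphism to a
finite field in which a given nonzero integer stays invertible. -/
theorem exists_subring_ringHom_finite_field {K : Type} [Field K] [CharZero K] {S : Set K}
    (hS : S.Finite) {N : ℕ} (hN : N ≠ 0) :
    ∃ (A : Subring K) (k : Type) (_ : Field k) (_ : Finite k) (_ : A →+* k),
      S ⊆ A ∧ (N : k) ≠ 0 := by
  -- With `N⁻¹` adjoined, `N` is a unit of `A` and survives modulo every maximal ideal.
  let T : Set K := insert ((N : K)⁻¹) S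
  have hT : T.Finite := hS.insert _
  let A := Algebra.adjoin ℤ T
  have hA : Algebra.FiniteType ℤ A :=
    (Subalgebra.fg_iff_finiteType A).1 ((Subalgebra.fg_def).2 ⟨T, hT, rfl⟩)
  obtain ⟨M, hM⟩ := Ideal.exists_maximal A
  let _ := Ideal.Quotient.field M
  have := isJacobsonRing_int
  -- Nullstellensatz over the Jacobson ring `ℤ`. The residue field is then a finitely generated
  -- abelian group: torsion, hence finite, in positive characteristic. Characteristic zero is
  -- impossible, since `ℤ` would be a field by integrality.
  have hfin : Module.Finite ℤ (A ⧸ M) := finite_of_finite_type_of_isJacobsonRing ℤ (A ⧸ M)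
  have hF : Finite (A ⧸ M) := by
    rcases CharP.exists (A ⧸ M) with ⟨q, hq⟩
    rcases CharP.char_is_prime_or_zero (A ⧸ M) q with hp | h0
    · refine AddCommGroup.finite_of_fg_isAddTorsion (hG' := Module.Finite.iff_addGroup_fg.1 hfin)
        (A ⧸ M) fun x => ?_
      rw [isOfFinAddOrder_iff_nsmul_eq_zero]
      exact ⟨q, hp.pos, by rw [nsmul_eq_mul, CharP.cast_eq_zero, zero_mul]⟩
    · subst h0
      have : CharZero (A ⧸ M) := CharP.charP_to_charZero _
      exfalso
      have h2 : Algebra.IsIntegral ℤ (A ⧸ M) := Algebra.IsIntegral.of_finite ℤ _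
      have h3 : FaithfulSMul ℤ (A ⧸ M) :=
        (faithfulSMul_iff_algebraMap_injective ℤ (A ⧸ M)).2 (RingHom.injective_int _)
      exact Int.not_isField
        (isField_of_isIntegral_of_isField (RingHom.injective_int (algebraMap ℤ (A ⧸ M)))
          (Field.toIsField (A ⧸ M)))
  have hNA : (N : K)⁻¹ ∈ A := Algebra.subset_adjoin (Set.mem_insert _ _)
  refine ⟨A.toSubring, A ⧸ M, inferInstance, hF, Ideal.Quotient.mk M,
    (Set.subset_insert _ _).trans Algebra.subset_adjoin, fun h => ?_⟩
  have h1 : (⟨(N : K)⁻¹, hNA⟩ : A) * (N : A) = 1 := by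
    ext
    simp [inv_mul_cancel₀ (Nat.cast_ne_zero.2 hN : (N : K) ≠ 0)]
  have h2 := congrArg (Ideal.Quotient.mk M) h1
  rw [map_mul, map_natCast, h, mul_zero, map_one] at h2
  exact zero_ne_one h2

variable {F : Type*} [Field F] {H : Type*} [Group H] {n : ℕ}

/-- The eigenspace of the representation `r` for the one-dimensional character `φ`. -/
def weightSpace (r : H →* Matrix (Fin n) (Fin n) F) (φ : H →* Fˣ) : Submodule F (Fin n → F) where
  carrier := {v | ∀ h, (r h).mulVec v = (φ h : F) • v}
  add_mem' := fun hv hw h => by rw [Matrix.mulVec_add, hv h, hw h, smul_add]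
  zero_mem' := fun h => by simp
  smul_mem' := fun c v hv h => by rw [Matrix.mulVec_smul, hv h, smul_comm]

theorem mem_weightSpace {r : H →* Matrix (Fin n) (Fin n) F} {φ : H →* Fˣ} {v : Fin n → F} :
    v ∈ weightSpace r φ ↔ ∀ h, (r h).mulVec v = (φ h : F) • v := Iff.rfl

/-- The multiplicity of a one-dimensional character in a representation is the dimension of the
eigenspace. -/
theorem average_trace_eq_finrank_weightSpace [Fintype H] (hH : (Fintype.card H : F) ≠ 0)
    (r : H →* Matrix (Fin n) (Fin n) F) (φ : H →* Fˣ) :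
    (Fintype.card H : F)⁻¹ * ∑ h, (φ h⁻¹ : F) * (r h).trace = finrank F (weightSpace r φ) := by
  -- The invariants of `φ⁻¹ ⊗ r` are the eigenspace, and averaging over `H` projects onto them; the
  -- trace of a projection is its rank, as an element of `F`.
  let ρ : Representation F H (Fin n → F) :=
    { toFun := fun h => (φ h⁻¹ : F) • Matrix.toLin' (r h)
      map_one' := by simp; rfl
      map_mul' := fun a b => by
        rw [mul_inv_rev, map_mul, map_mul, Matrix.toLin'_mul, Units.val_mul]
        ext v i
        simp [mul_assoc, mul_left_comm] }
  have hinv : ρ.invariants = weightSpace r φ := by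
    ext v
    rw [Representation.mem_invariants, mem_weightSpace]
    refine forall_congr' fun h => ?_
    change (φ h⁻¹ : F) • Matrix.toLin' (r h) v = v ↔ _
    rw [map_inv, Matrix.toLin'_apply, Units.val_inv_eq_inv_val,
      inv_smul_eq_iff₀ (Units.ne_zero _)]
  let := invertibleOfNonzero hH
  have h1 := ρ.isProj_averageMap.trace
  rw [← hinv, ← h1]
  simp only [Representation.averageMap, GroupAlgebra.average, map_smul, map_sum,
    Representation.asAlgebraHom_of, smul_eq_mul, invOf_eq_inv]
  congr 1
  refine Finset.sum_congr rfl fun h _ => ?_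
  change _ = LinearMap.trace F _ ((φ h⁻¹ : F) • Matrix.toLin' (r h))
  rw [map_smul, Matrix.trace_toLin'_eq, smul_eq_mul]

end Reduction

/-! ### Reduction of representations, and conjugation on the poset of pairs -/

section Pairs

theorem hasEnoughRootsOfUnity_Zbar (p : ℕ) [Fact p.Prime] (m : ℕ) [NeZero m] :
    HasEnoughRootsOfUnity (Zbar p) m := by
  refine ⟨?_, rootsOfUnity.isCyclic _ _⟩
  obtain ⟨ζ, hζ⟩ := HasEnoughRootsOfUnity.exists_primitiveRoot (PadicAlgCl p) m
  have hint : IsIntegral ℤ_[p] ζ := hζ.isIntegral (NeZero.pos m) |>.tower_top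
  exact ⟨⟨ζ, hint⟩, IsPrimitiveRoot.of_map_of_injective (f := (integralClosure ℤ_[p] (PadicAlgCl p)).val)
    hζ Subtype.val_injective⟩

/-- A positive difference of two numbers up to `n` divides `n!`, so it cannot vanish in `F`. This
recovers dimensions from their residues in a field of positive characteristic. -/
theorem eq_of_natCast_eq_of_le {F : Type*} [Field F] {a b n : ℕ} (hn : (n.factorial : F) ≠ 0)
    (ha : a ≤ n) (hb : b ≤ n) (h : (a : F) = b) : a = b := by
  wlog hab : a ≤ b generalizing a b
  · exact (this hb ha h.symm (le_of_not_ge hab)).symm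
  by_contra hne
  have h1 : ((b - a : ℕ) : F) = 0 := by rw [Nat.cast_sub hab, h, sub_self]
  obtain ⟨c, hc⟩ := Nat.dvd_factorial (m := b - a) (n := n) (by omega) (by omega)
  exact hn (by rw [hc, Nat.cast_mul, h1, zero_mul])

variable {p : ℕ} [Fact p.Prime] {G : Type*} [Group G]

/-- The character of a pair of a finite group, with values in the roots of unity. -/
def MonPair.rootHom (P : MonPair p G) : P.U →* rootsOfUnity (Nat.card G) (Zbar p) :=
  P.φ.codRestrict (rootsOfUnity (Nat.card G) (Zbar p)) fun u => by
    rw [mem_rootsOfUnity, ← map_pow]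
    have : u ^ Nat.card G = 1 := Subtype.ext (by simp)
    rw [this, map_one]

/-- A representation of a finite group over `ℚ̄_p` has a reduction to a finite field with the same
multiplicities of one-dimensional characters of subgroups. -/
theorem exists_reduction [Finite G] {n : ℕ} (r : G →* Matrix (Fin n) (Fin n) (PadicAlgCl p)) :
    ∃ (k : Type) (_ : Field k) (_ : Finite k) (s : G →* Matrix (Fin n) (Fin n) k)
      (f : rootsOfUnity (Nat.card G) (Zbar p) →* kˣ),
      Function.Injective f ∧ (∀ l : kˣ, l ^ Nat.card G = 1 → ∃ x, f x = l) ∧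
      ∀ P : MonPair p G, P.inner (fun g => (r g).trace) =
        finrank k (weightSpace (s.comp P.U.subtype) (f.comp P.rootHom)) := by
  classical
  have := Fintype.ofFinite G
  set m := Nat.card G with hm
  have hm0 : NeZero m := ⟨Nat.card_pos.ne'⟩
  have := hasEnoughRootsOfUnity_Zbar p m
  let c : rootsOfUnity m (Zbar p) →* PadicAlgCl p :=
    ((integralClosure ℤ_[p] (PadicAlgCl p)).val : Zbar p →* PadicAlgCl p).comp
      ((Units.coeHom _).comp (rootsOfUnity m (Zbar p)).subtype)
  have hc : Function.Injective c :=
    Subtype.val_injective.comp (Units.val_injective.comp Subtype.val_injective)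
  let S : Set (PadicAlgCl p) := (Set.range fun x : G × Fin n × Fin n => r x.1 x.2.1 x.2.2) ∪
    Set.range c
  have hS : S.Finite := (Set.finite_range _).union (Set.finite_range _)
  -- The factor `n!` allows dimensions up to `n` to be read off in `k`; the factor `m = |G|` keeps
  -- subgroup averages defined and roots of unity distinct.
  obtain ⟨A, k, _, _, π, hSA, hN⟩ := exists_subring_ringHom_finite_field hS
    (mul_ne_zero (Nat.factorial_ne_zero n) hm0.out)
  rw [Nat.cast_mul, mul_ne_zero_iff] at hN
  have hr : ∀ g i j, r g i j ∈ A := fun g i j => hSA (Or.inl ⟨(g, i, j), rfl⟩)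
  let rA : G →* Matrix (Fin n) (Fin n) A :=
    { toFun := fun g => Matrix.of fun i j => ⟨r g i j, hr g i j⟩
      map_one' := by
        ext i j
        simp only [map_one, Matrix.of_apply, Matrix.one_apply]
        split_ifs <;> rfl
      map_mul' := fun a b => by
        ext i j
        simp [Matrix.mul_apply] }
  let cA : rootsOfUnity m (Zbar p) →* A := c.codRestrict A fun x => hSA (Or.inr ⟨x, rfl⟩)
  let f : rootsOfUnity m (Zbar p) →* kˣ := ((π : A →* k).comp cA).toHomUnits
  -- An `m`-th root of unity `x ≠ 1` satisfies `1 + x + ⋯ + x^{m-1} = 0`; if it reduced to `1`, this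
  -- would say `m = 0` in `k`.
  have hf : Function.Injective f := by
    rw [injective_iff_map_eq_one]
    intro x hx
    by_contra hx1
    have h1 : cA x ≠ 1 := fun h => hx1 (hc (by rw [map_one]; exact congrArg Subtype.val h))
    have h2 : cA x ^ m = 1 := by
      rw [← map_pow, (Subtype.ext ((mem_rootsOfUnity _ _).1 x.2) : x ^ m = 1), map_one]
    have h3 : ∑ i ∈ Finset.range m, cA x ^ i = 0 := by
      have := mul_geom_sum (cA x) m
      rw [h2, sub_self] at this
      exact (mul_eq_zero.1 this).resolve_left (sub_ne_zero.2 h1)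
    have h4 : π (cA x) = 1 := congrArg Units.val hx
    have h5 := congrArg π h3
    simp only [map_sum, map_pow, h4, one_pow, map_zero, Finset.sum_const, Finset.card_range,
      nsmul_eq_mul, mul_one] at h5
    exact hN.2 h5
  refine ⟨k, inferInstance, inferInstance, (RingHom.toMonoidHom π.mapMatrix).comp rA, f, hf, ?_, ?_⟩
  -- The field `k` has at most `m` roots of unity of order dividing `m`, so an injection from `m` of
  -- them is onto.
  · let f' : rootsOfUnity m (Zbar p) →* rootsOfUnity m k := f.codRestrict _ fun x => by
      rw [mem_rootsOfUnity, ← map_pow,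
        (Subtype.ext ((mem_rootsOfUnity _ _).1 x.2) : x ^ m = 1), map_one]
    have hf' : Function.Injective f' := fun x y h => hf (congrArg Subtype.val h)
    have hb := hf'.bijective_of_nat_card_le (by
      rw [HasEnoughRootsOfUnity.natCard_rootsOfUnity (Zbar p) m]
      exact card_rootsOfUnity k m)
    intro l hl
    obtain ⟨x, hx⟩ := hb.2 ⟨l, (mem_rootsOfUnity _ _).2 hl⟩
    exact ⟨x, congrArg Subtype.val hx⟩
  · intro P
    have hU : ∀ {F : Type} [Field F], (m : F) ≠ 0 → (Fintype.card P.U : F) ≠ 0 := by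
      intro F _ h1 h2
      obtain ⟨d, hd⟩ := P.U.card_subgroup_dvd_card
      rw [Nat.card_eq_fintype_card (α := P.U)] at hd
      exact h1 (by rw [hm, hd, Nat.cast_mul, h2, zero_mul])
    have hK := average_trace_eq_finrank_weightSpace (hU (F := PadicAlgCl p) (by
      exact_mod_cast hm0.out)) (r.comp P.U.subtype)
      ((Units.map ((integralClosure ℤ_[p] (PadicAlgCl p)).val : Zbar p →* PadicAlgCl p)).comp P.φ)
    have hk := average_trace_eq_finrank_weightSpace (hU hN.2)
      (((RingHom.toMonoidHom π.mapMatrix).comp rA).comp P.U.subtype) (f.comp P.rootHom)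
    rw [MonPair.inner, finsum_eq_sum_of_fintype, Nat.card_eq_fintype_card]
    refine hK.trans ?_
    rw [inv_mul_eq_iff_eq_mul₀ (hU (by exact_mod_cast hm0.out))] at hK
    rw [inv_mul_eq_iff_eq_mul₀ (hU hN.2)] at hk
    -- The multiplicity formula over `ℚ̄_p`, cleared of its denominator, is an identity in `A`.
    -- Applying `π` makes it comparable with the formula over `k`.
    have hA : ∑ u : P.U, cA (P.rootHom u⁻¹) * (rA u).trace = (Fintype.card P.U : A) *
        (finrank (PadicAlgCl p) (weightSpace (r.comp P.U.subtype)
          ((Units.map ((integralClosure ℤ_[p] (PadicAlgCl p)).val : Zbar p →* PadicAlgCl p)).comp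
            P.φ)) : A) := by
      apply Subtype.val_injective
      push_cast
      rw [← hK]
      refine Finset.sum_congr rfl fun u _ => ?_
      congr 1
      simp [Matrix.trace, rA]
    have h2 := congrArg π hA
    rw [map_mul, map_natCast, map_natCast, map_sum] at h2
    have h3 := h2.symm.trans ((Finset.sum_congr rfl fun u _ => ?_).trans hk)
    · have h4 := mul_left_cancel₀ (hU hN.2) h3
      have hle : ∀ {F : Type} [Field F] (W : Submodule F (Fin n → F)), finrank F W ≤ n :=
        fun W => (Submodule.finrank_le W).trans_eq (by simp)
      rw [eq_of_natCast_eq_of_le hN.1 (hle _) (hle _) h4]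
    · rw [map_mul]
      congr 1
      simp [Matrix.trace]

/-- `μ(a, b)` is defined recursively from the interval `[a, b)`, so induction on the size of that
interval applies. -/
theorem mu_orderIso {α β : Type*} [PartialOrder α] [LocallyFiniteOrder α] [DecidableEq α]
    [PartialOrder β] [LocallyFiniteOrder β] [DecidableEq β] (e : α ≃o β) (a b : α) :
    IncidenceAlgebra.mu ℤ (e a) (e b) = IncidenceAlgebra.mu ℤ a b := by
  induction h : (Finset.Ico a b).card using Nat.strong_induction_on generalizing b with
  | _ N ih =>
    rw [IncidenceAlgebra.mu_apply, IncidenceAlgebra.mu_apply (a := a)]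
    simp only [EmbeddingLike.apply_eq_iff_eq]
    split_ifs with hab
    · rfl
    · congr 1
      symm
      refine Finset.sum_equiv e.toEquiv (fun x => by simp) fun x hx => ?_
      refine (ih _ ?_ x rfl).symm
      rw [← h]
      rw [Finset.mem_Ico] at hx
      refine Finset.card_lt_card (Finset.ssubset_iff_subset_ne.2
        ⟨Finset.Ico_subset_Ico_right hx.2.le, fun h' => ?_⟩)
      have : x ∈ Finset.Ico a x := h' ▸ Finset.mem_Ico.2 hx
      simp at this

namespace MonPair

theorem le_iff {P Q : MonPair p G} :
    P ≤ Q ↔ ∀ g (hg : g ∈ P.U), ∃ h : g ∈ Q.U, Q.φ ⟨g, h⟩ = P.φ ⟨g, hg⟩ :=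
  ⟨fun ⟨h1, h2⟩ g hg => ⟨h1 hg, h2 ⟨g, hg⟩⟩,
    fun h => ⟨fun g hg => (h g hg).1, fun u => (h u u.2).2⟩⟩

theorem mem_conj {g x : G} {P : MonPair p G} : x ∈ (P.conj g).U ↔ g⁻¹ * x * g ∈ P.U := by
  constructor
  · rintro ⟨y, hy, rfl⟩
    simpa [mul_assoc] using hy
  · intro h
    exact ⟨_, h, by simp [mul_assoc]⟩

theorem conj_φ {g x : G} {P : MonPair p G} (hx : x ∈ (P.conj g).U) :
    (P.conj g).φ ⟨x, hx⟩ = P.φ ⟨g⁻¹ * x * g, mem_conj.1 hx⟩ := by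
  change P.φ (((MulAut.conj g).subgroupMap P.U).symm ⟨x, hx⟩) = _
  congr 1

theorem φ_congr {P : MonPair p G} {x y : G} (h : x = y) (hx : x ∈ P.U) :
    P.φ ⟨x, hx⟩ = P.φ ⟨y, h ▸ hx⟩ := by subst h; rfl

instance : MulAction G (MonPair p G) where
  smul := conj
  one_smul P := by
    change conj 1 P = P
    refine le_antisymm (le_iff.2 fun g hg => ?_) (le_iff.2 fun g hg => ?_)
    · have := mem_conj.1 hg
      refine ⟨by simpa using this, ?_⟩
      rw [conj_φ]
      exact φ_congr (by simp) _
    · refine ⟨mem_conj.2 (by simpa using hg), ?_⟩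
      rw [conj_φ]
      exact φ_congr (by simp) _
  mul_smul a b P := by
    change conj (a * b) P = conj a (conj b P)
    refine le_antisymm (le_iff.2 fun g hg => ?_) (le_iff.2 fun g hg => ?_)
    · have := mem_conj.1 hg
      refine ⟨mem_conj.2 (mem_conj.2 (by simpa [mul_assoc] using this)), ?_⟩
      rw [conj_φ, conj_φ, conj_φ]
      exact φ_congr (by simp [mul_assoc]) _
    · have := mem_conj.1 (mem_conj.1 hg)
      refine ⟨mem_conj.2 (by simpa [mul_assoc] using this), ?_⟩
      rw [conj_φ, conj_φ, conj_φ]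
      exact φ_congr (by simp [mul_assoc]) _

theorem smul_def (g : G) (P : MonPair p G) : g • P = P.conj g := rfl

theorem smul_le_smul_iff {g : G} {P Q : MonPair p G} : g • P ≤ g • Q ↔ P ≤ Q := by
  have key : ∀ (g : G) {P Q : MonPair p G}, P ≤ Q → g • P ≤ g • Q := by
    intro g P Q h
    rw [le_iff] at h ⊢
    intro x hx
    obtain ⟨h1, h2⟩ := h _ (mem_conj.1 hx)
    exact ⟨mem_conj.2 h1, by simp only [smul_def, conj_φ, h2]⟩
  exact ⟨fun h => by simpa using key g⁻¹ h, key g⟩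

/-- Conjugation as an automorphism of the poset of pairs. -/
def conjIso (g : G) : MonPair p G ≃o MonPair p G where
  toEquiv := MulAction.toPerm g
  map_rel_iff' := smul_le_smul_iff

/-- Conjugation by `u ∈ U` is inner on `U` and `φ` has commutative target. Thus `U` lies in the
stabilizer of `P`, and `|Stab(P)|/|U|` is an integer. -/
theorem smul_eq_self_of_mem {P : MonPair p G} {u : G} (hu : u ∈ P.U) : u • P = P := by
  have key : ∀ u ∈ P.U, u • P ≤ P := by
    intro u hu
    refine le_iff.2 fun x hx => ?_
    have h1 : u⁻¹ * x * u ∈ P.U := mem_conj.1 hx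
    have hx' : x ∈ P.U := by
      simpa [mul_assoc] using P.U.mul_mem (P.U.mul_mem hu h1) (P.U.inv_mem hu)
    refine ⟨hx', ?_⟩
    refine Eq.trans ?_ (conj_φ hx).symm
    have : (⟨u⁻¹ * x * u, h1⟩ : P.U) = ⟨u, hu⟩⁻¹ * ⟨x, hx'⟩ * ⟨u, hu⟩ := rfl
    rw [this, map_mul, map_mul, map_inv, mul_comm, mul_inv_cancel_left]
  refine le_antisymm (key u hu) ?_
  have := smul_le_smul_iff (g := u).2 (key u⁻¹ (P.U.inv_mem hu))
  simpa using this

end MonPair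

end Pairs

/-! ### Counting vectors over a finite field by the stabilizer of their line -/

section Count

variable {p : ℕ} [Fact p.Prime] {G : Type*} [Group G]
variable {k : Type*} [Field k] {n : ℕ}

/-- The eigenspace of a pair in a representation over `k`, where the values of characters are
transported to `k` along `f`. -/
abbrev MonPair.weightSpace (s : G →* Matrix (Fin n) (Fin n) k)
    (f : rootsOfUnity (Nat.card G) (Zbar p) →* kˣ) (P : MonPair p G) :
    Submodule k (Fin n → k) :=
  BrauerIwasawa.weightSpace (s.comp P.U.subtype) (f.comp P.rootHom)

variable {s : G →* Matrix (Fin n) (Fin n) k} {f : rootsOfUnity (Nat.card G) (Zbar p) →* kˣ}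

theorem MonPair.mem_weightSpace {P : MonPair p G} {v : Fin n → k} :
    v ∈ P.weightSpace s f ↔ ∀ g (hg : g ∈ P.U),
      (s g).mulVec v = (f (P.rootHom ⟨g, hg⟩) : k) • v :=
  ⟨fun h g hg => h ⟨g, hg⟩, fun h g => h g.1 g.2⟩

/-- The stabilizer of a line, with its action on the line, is the largest pair with the line in
its eigenspace. -/
theorem exists_forall_le_iff_mem_weightSpace (hf : Function.Injective f)
    (hf' : ∀ l : kˣ, l ^ Nat.card G = 1 → ∃ x, f x = l) {v : Fin n → k} (hv : v ≠ 0) :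
    ∃ Q : MonPair p G, (∀ P : MonPair p G, P ≤ Q ↔ v ∈ P.weightSpace s f) ∧
      ∀ (g : G) (l : kˣ), (s g).mulVec v = (l : k) • v → g ∈ Q.U := by
  have huniq : ∀ {a b : kˣ}, (a : k) • v = (b : k) • v → a = b := fun h =>
    Units.ext (smul_left_injective k hv h)
  let U : Subgroup G :=
    { carrier := {g | ∃ l : kˣ, (s g).mulVec v = (l : k) • v}
      mul_mem' := by
        rintro a b ⟨l, hl⟩ ⟨l', hl'⟩
        exact ⟨l * l', by rw [map_mul, ← Matrix.mulVec_mulVec, hl', Matrix.mulVec_smul, hl,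
          smul_smul, mul_comm, Units.val_mul]⟩
      one_mem' := ⟨1, by simp⟩
      inv_mem' := by
        rintro a ⟨l, hl⟩
        refine ⟨l⁻¹, ?_⟩
        have h1 : (s a⁻¹).mulVec ((s a).mulVec v) = v := by
          rw [Matrix.mulVec_mulVec, ← map_mul, inv_mul_cancel, map_one, Matrix.one_mulVec]
        rw [hl, Matrix.mulVec_smul] at h1
        rw [Units.val_inv_eq_inv_val, eq_inv_smul_iff₀ l.ne_zero, h1] }
  have hU : ∀ u : U, ∃ l : kˣ, (s u).mulVec v = (l : k) • v := fun u => u.2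
  choose l hl using hU
  let lh : U →* kˣ :=
    { toFun := l
      map_one' := huniq (by rw [← hl]; simp)
      map_mul' := fun a b => huniq (by
        rw [← hl, Subgroup.coe_mul, map_mul, ← Matrix.mulVec_mulVec, hl b, Matrix.mulVec_smul,
          hl a, smul_smul, mul_comm, Units.val_mul]) }
  -- The eigenvalues on the line are roots of unity of order dividing `|G|`, so they lift along `f`
  -- to a character with values in `ℤ̄_pˣ`.
  have hx : ∀ u : U, ∃ x, f x = lh u := fun u => hf' _ (by
    rw [← map_pow, (Subtype.ext (by simp) : u ^ Nat.card G = 1), map_one])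
  choose x hx using hx
  let xh : U →* rootsOfUnity (Nat.card G) (Zbar p) :=
    { toFun := x
      map_one' := hf (by rw [hx, map_one, map_one])
      map_mul' := fun a b => hf (by rw [hx, map_mul, map_mul, hx, hx]) }
  refine ⟨⟨U, (rootsOfUnity _ _).subtype.comp xh⟩, fun P => ?_, fun g l h => ⟨l, h⟩⟩
  rw [MonPair.le_iff, MonPair.mem_weightSpace]
  refine forall₂_congr fun g hg => ⟨?_, fun h => ?_⟩
  · rintro ⟨h1, h2⟩
    have h3 : x ⟨g, h1⟩ = P.rootHom ⟨g, hg⟩ := Subtype.ext h2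
    rw [← h3, hx]
    exact hl ⟨g, h1⟩
  · refine ⟨⟨_, h⟩, ?_⟩
    have h3 : x ⟨g, ⟨_, h⟩⟩ = P.rootHom ⟨g, hg⟩ :=
      hf (by rw [hx]; exact huniq ((hl ⟨g, ⟨_, h⟩⟩).symm.trans h))
    exact congrArg Subtype.val h3

/-- `s g` carries the eigenspace of `P` to that of `gPg⁻¹`, and scalars preserve eigenspaces. This
gives the equivariance of the strata under `G × kˣ`. -/
theorem MonPair.mem_weightSpace_smul {g : G} {P : MonPair p G} {v : Fin n → k} (a : kˣ) :
    (a : k) • (s g).mulVec v ∈ (g • P).weightSpace s f ↔ v ∈ P.weightSpace s f := by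
  rw [Submodule.smul_mem_iff _ a.ne_zero]
  have key : ∀ (g : G) {P : MonPair p G} {v : Fin n → k}, v ∈ P.weightSpace s f →
      (s g).mulVec v ∈ (g • P).weightSpace s f := by
    intro g P v h
    rw [MonPair.mem_weightSpace] at h ⊢
    intro x hx
    have h1 := h _ (MonPair.mem_conj.1 hx)
    have h2 : (g • P).rootHom ⟨x, hx⟩ = P.rootHom ⟨_, MonPair.mem_conj.1 hx⟩ :=
      Subtype.ext (MonPair.conj_φ hx)
    rw [h2, ← Matrix.mulVec_smul, ← h1, Matrix.mulVec_mulVec, Matrix.mulVec_mulVec, ← map_mul,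
      ← map_mul]
    simp [mul_assoc]
  refine ⟨fun h => ?_, key g⟩
  have := key g⁻¹ h
  rwa [inv_smul_smul, Matrix.mulVec_mulVec, ← map_mul, inv_mul_cancel, map_one,
    Matrix.one_mulVec] at this

/-- Every orbit has exactly `|H|/u = t` elements. -/
theorem card_dvd_of_forall_card_stabilizer {H X : Type*} [Group H] [MulAction H X] [Finite H]
    [Finite X] {u t : ℕ} (hu : ∀ x : X, Nat.card (MulAction.stabilizer H x) = u)
    (ht : Nat.card H = t * u) : t ∣ Nat.card X := by
  classical
  have := Fintype.ofFinite H
  have := Fintype.ofFinite X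
  rw [Nat.card_eq_fintype_card, MulAction.card_eq_sum_card_group_div_card_stabilizer H X]
  refine Finset.dvd_sum fun ω _ => ?_
  have h1 := hu (Quotient.out ω)
  rw [Nat.card_eq_fintype_card] at h1 ht
  rw [h1, ht, Nat.mul_div_cancel _ (by rw [← h1]; exact Fintype.card_pos)]

/-- The vectors whose line has stabilizer pair `P` fall into orbits of constant size. -/
theorem dvd_card_stratum [Finite G] [Finite k] (Q : {v : Fin n → k // v ≠ 0} → MonPair p G)
    (hQ : ∀ v P, P ≤ Q v ↔ v.1 ∈ P.weightSpace s f)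
    (hQ' : ∀ v (g : G) (l : kˣ), (s g).mulVec v.1 = (l : k) • v.1 → g ∈ (Q v).U) (P : MonPair p G) {t : ℕ}
    (ht : Nat.card (MulAction.stabilizer G P) = t * Nat.card P.U) :
    t * Nat.card kˣ ∣ Nat.card {v // Q v = P} := by
  have hne : ∀ (g : G) (a : kˣ) {v : Fin n → k}, v ≠ 0 → (a : k) • (s g).mulVec v ≠ 0 := by
    intro g a v hv h
    rw [smul_eq_zero_iff_right a.ne_zero] at h
    have h1 : (s g⁻¹).mulVec ((s g).mulVec v) = v := by
      rw [Matrix.mulVec_mulVec, ← map_mul, inv_mul_cancel, map_one, Matrix.one_mulVec]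
    rw [h, Matrix.mulVec_zero] at h1
    exact hv h1.symm
  -- A pair is determined by the pairs below it, and those below `Q v` are the ones whose eigenspace
  -- contains `v`.
  have hQs : ∀ (g : G) (a : kˣ) (v : {v : Fin n → k // v ≠ 0}),
      Q ⟨(a : k) • (s g).mulVec v.1, hne g a v.2⟩ = g • Q v := by
    intro g a v
    refine eq_of_forall_le_iff fun R => ?_
    obtain ⟨R, rfl⟩ := MulAction.surjective g R
    rw [hQ, MonPair.mem_weightSpace_smul, MonPair.smul_le_smul_iff, hQ]
  let act : MulAction (MulAction.stabilizer G P × kˣ) {v // Q v = P} :=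
    { smul := fun h v => ⟨⟨(h.2 : k) • (s h.1).mulVec v.1.1, hne _ _ v.1.2⟩, by
        rw [hQs, v.2]; exact h.1.2⟩
      one_smul := fun v => by
        apply Subtype.ext
        apply Subtype.ext
        change ((1 : kˣ) : k) • (s (1 : G)).mulVec v.1.1 = v.1.1
        simp
      mul_smul := fun a b v => by
        apply Subtype.ext
        apply Subtype.ext
        change ((a.2 * b.2 : kˣ) : k) • (s ((a.1 * b.1 : MulAction.stabilizer G P) : G)).mulVec
          v.1.1 = (a.2 : k) • (s a.1).mulVec ((b.2 : k) • (s b.1).mulVec v.1.1)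
        rw [Matrix.mulVec_smul, Matrix.mulVec_mulVec, smul_smul, ← map_mul]
        simp }
  refine card_dvd_of_forall_card_stabilizer (H := MulAction.stabilizer G P × kˣ)
    (u := Nat.card P.U) (fun v => ?_) (by rw [Nat.card_prod, ht]; ring)
  have hv : v.1.1 ∈ P.weightSpace s f := (hQ v.1 P).1 v.2.ge
  rw [MonPair.mem_weightSpace] at hv
  have hmem : ∀ h : MulAction.stabilizer G P × kˣ, h ∈ MulAction.stabilizer _ v ↔
      (h.2 : k) • (s h.1).mulVec v.1.1 = v.1.1 := fun h => by
    rw [MulAction.mem_stabilizer_iff, ← Subtype.val_inj, ← Subtype.val_inj]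
    rfl
  -- If `(g, a)` fixes `v`, then `g` acts on the line of `v` by `a⁻¹`, so `g` lies in the subgroup
  -- of `Q v = P`.
  have hU : ∀ h : MulAction.stabilizer G P × kˣ, h ∈ MulAction.stabilizer _ v →
      (h.1 : G) ∈ P.U := by
    intro h hh
    rw [hmem] at hh
    refine (congrArg (fun R : MonPair p G => (h.1 : G) ∈ R.U) v.2).mp (hQ' v.1 _ h.2⁻¹ ?_)
    rw [Units.val_inv_eq_inv_val, eq_inv_smul_iff₀ h.2.ne_zero, hh]
  symm
  -- The stabilizer of `v` is the graph `u ↦ (u, φ(u)⁻¹)` over `U`: the scalar is forced because `v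
  -- ≠ 0`.
  refine Nat.card_congr (Equiv.ofBijective (fun u : P.U =>
    ⟨(⟨u, MonPair.smul_eq_self_of_mem u.2⟩, (f (P.rootHom u))⁻¹), by
      rw [hmem]
      change _ • (s (u : G)).mulVec _ = _
      rw [hv u u.2, smul_smul]
      simp⟩) ⟨fun a b h => ?_, fun h => ?_⟩)
  · exact Subtype.ext (congrArg (fun x => (x.1.1 : G)) h)
  · refine ⟨⟨h.1.1, hU _ h.2⟩, ?_⟩
    have h1 := (hmem _).1 h.2
    rw [hv _ (hU _ h.2), smul_smul] at h1
    refine Subtype.ext (Prod.ext rfl ?_)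
    change (f _)⁻¹ = h.1.2
    rw [inv_eq_iff_mul_eq_one]
    apply Units.ext
    refine smul_left_injective k v.1.2 ?_
    simpa [mul_comm] using h1

/-- The nonzero vectors of the eigenspace of `P` are sorted by `R = Q v`, which runs over the pairs
above `P`; the `-1` removes the zero vector. -/
theorem pow_sub_one_eq_card_sum [Finite G] [Finite k] (Q : {v : Fin n → k // v ≠ 0} → MonPair p G)
    (hQ : ∀ v P, P ≤ Q v ↔ v.1 ∈ P.weightSpace s f) (P : MonPair p G) [DecidableLE (MonPair p G)] :
    ((Nat.card k : ℤ) ^ finrank k (P.weightSpace s f) - 1) =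
      ∑ R : MonPair p G with P ≤ R, (Nat.card {v // Q v = R} : ℤ) := by
  classical
  have := Fintype.ofFinite k
  have h1 : Nat.card (P.weightSpace s f) = Nat.card k ^ finrank k (P.weightSpace s f) :=
    Module.natCard_eq_pow_finrank
  have h2 : Nat.card (P.weightSpace s f) = Nat.card {v // P ≤ Q v} + 1 := by
    rw [← Finite.card_option]
    refine Nat.card_congr ((Equiv.optionSubtype (0 : P.weightSpace s f)).symm ?_).1.symm
    exact
      { toFun := fun v => ⟨⟨v.1.1, (hQ _ _).1 v.2⟩, fun h => v.1.2 (congrArg Subtype.val h)⟩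
        invFun := fun w => ⟨⟨w.1.1, fun h => w.2 (Subtype.ext h)⟩, (hQ _ _).2 w.1.2⟩
        left_inv := fun v => rfl
        right_inv := fun w => rfl }
  have h3 : Nat.card {v // P ≤ Q v} =
      ∑ R : MonPair p G with P ≤ R, Nat.card {v // Q v = R} := by
    simp only [Nat.card_eq_fintype_card, Fintype.card_subtype]
    rw [Finset.card_eq_sum_card_fiberwise (f := Q)
      (t := Finset.univ.filter fun R => P ≤ R) (fun v hv => by simpa using hv)]
    refine Finset.sum_congr rfl fun R hR => ?_
    congr 1
    ext v
    simp only [Finset.mem_filter, Finset.mem_univ, true_and] at hR ⊢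
    exact ⟨fun h => h.2, fun h => ⟨h ▸ hR, h⟩⟩
  have h4 : (Nat.card k : ℤ) ^ finrank k (P.weightSpace s f) = Nat.card {v // P ≤ Q v} + 1 := by
    exact_mod_cast h1.symm.trans h2
  rw [h4, h3]
  push_cast
  ring

open Classical in
-- After exchanging the sums, the coefficient of `c z` is the sum of `μ(x, y)` over `x ≤ y ≤ z`,
-- which vanishes unless `z = x`.
theorem moebius_inversion_filter_le {α : Type*} [PartialOrder α] [Fintype α] [LocallyFiniteOrder α]
    (c g : α → ℤ) (h : ∀ x, g x = ∑ y with x ≤ y, c y) (x : α) :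
    ∑ y with x ≤ y, IncidenceAlgebra.mu ℤ x y * g y = c x := by
  simp_rw [h, Finset.mul_sum]
  rw [Finset.sum_comm' (t' := Finset.univ.filter fun z => x ≤ z) (s' := fun z => Finset.Icc x z)
    (fun y z => by
      simp only [Finset.mem_filter, Finset.mem_univ, true_and, Finset.mem_Icc]
      exact ⟨fun h => ⟨h, h.1.trans h.2⟩, fun h => h.1⟩)]
  simp_rw [← Finset.sum_mul, IncidenceAlgebra.sum_Icc_mu_right]
  simp

open Classical in
/-- The Möbius sum of the multiplicities of the pairs above `P` is divisible by the index of the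
subgroup of `P` in the stabilizer of `P`. -/
theorem dvd_sum_mu_mul_finrank [Finite G] [Finite k] (hf : Function.Injective f)
    (hf' : ∀ l : kˣ, l ^ Nat.card G = 1 → ∃ x, f x = l) (P : MonPair p G) {t : ℕ}
    (ht : Nat.card (MulAction.stabilizer G P) = t * Nat.card P.U) :
    (t : ℤ) ∣ ∑ R : MonPair p G with P ≤ R,
      IncidenceAlgebra.mu ℤ P R * (finrank k (R.weightSpace s f) : ℤ) := by
  have hm : NeZero (Nat.card G) := ⟨Nat.card_pos.ne'⟩
  have := hasEnoughRootsOfUnity_Zbar p (Nat.card G)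
  choose Q hQ hQ' using fun v : {v : Fin n → k // v ≠ 0} =>
    exists_forall_le_iff_mem_weightSpace (s := s) hf hf' v.2
  have := Fintype.ofFinite k
  have hkx : (Nat.card kˣ : ℤ) = Nat.card k - 1 := by
    rw [Nat.card_units, Nat.cast_sub Nat.card_pos]
    simp
  have hkx0 : (Nat.card k : ℤ) - 1 ≠ 0 := by
    rw [← hkx]
    exact_mod_cast Nat.card_pos.ne'
  -- `t` divides `|G|`, which is the order of the group of roots of unity embedded in `kˣ` by `f`.
  have hq : (t : ℤ) ∣ Nat.card k - 1 := by
    rw [← hkx]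
    have h1 := Subgroup.card_dvd_of_injective f hf
    rw [HasEnoughRootsOfUnity.natCard_rootsOfUnity (Zbar p)] at h1
    exact_mod_cast ((Dvd.intro _ ht.symm).trans (Subgroup.card_subgroup_dvd_card _)).trans h1
  have h1 := moebius_inversion_filter_le _ _ (fun R => pow_sub_one_eq_card_sum Q hQ R) P
  have h2 : ((Nat.card k : ℤ) - 1) * t ∣ (Nat.card {v // Q v = P} : ℤ) := by
    rw [← hkx, mul_comm]
    exact_mod_cast dvd_card_stratum Q hQ hQ' P ht
  rw [← h1] at h2
  -- Each `q^d - 1` is `(q - 1)(1 + ⋯ + q^{d-1})`, so the factor `q - 1` cancels from both sides of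
  -- the divisibility.
  simp_rw [← mul_geom_sum, mul_left_comm _ ((Nat.card k : ℤ) - 1)] at h2
  rw [← Finset.mul_sum] at h2
  have h3 := Int.dvd_of_mul_dvd_mul_left hkx0 h2
  -- Modulo `t` every power of `q` is `1`, so the geometric sum of length `d` may be replaced by
  -- `d`.
  rw [← dvd_sub_right h3, ← Finset.sum_sub_distrib]
  refine Finset.dvd_sum fun R _ => ?_
  rw [← mul_sub]
  refine Dvd.dvd.mul_left (hq.trans ?_) _
  generalize finrank k (R.weightSpace s f) = d
  have h4 : ∑ i ∈ Finset.range d, (Nat.card k : ℤ) ^ i - d =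
      ∑ i ∈ Finset.range d, ((Nat.card k : ℤ) ^ i - 1) := by simp
  rw [h4]
  exact Finset.dvd_sum fun i _ => sub_one_dvd_pow_sub_one _ i

end Count

/-! ### Integrality of the coefficients and existence of representing tuples -/

section Integrality

variable {p : ℕ} [Fact p.Prime] {G : Type*} [Group G]

theorem VChar.induction [TopologicalSpace G] {motive : (G → PadicAlgCl p) → Prop}
    (char : ∀ f, IsCharacter p G f → motive f) (zero : motive 0)
    (add : ∀ f g, motive f → motive g → motive (f + g)) (neg : ∀ f, motive f → motive (-f))
    (ρ : VChar p G) : motive ρ.1 := by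
  obtain ⟨ρ, hρ⟩ := ρ
  induction hρ using AddSubgroup.closure_induction with
  | mem x hx => exact char x hx
  | zero => exact zero
  | add x y _ _ h1 h2 => exact add _ _ h1 h2
  | neg x _ h => exact neg _ h

theorem VChar.apply_conj [TopologicalSpace G] (ρ : VChar p G) (g x : G) :
    ρ.1 (g * x * g⁻¹) = ρ.1 x := by
  refine VChar.induction (motive := fun f => f (g * x * g⁻¹) = f x) ?_ rfl ?_ ?_ ρ
  · rintro f ⟨n, r, -, hr⟩
    rw [hr, hr, map_mul, map_mul, Matrix.trace_mul_comm, ← mul_assoc, ← map_mul, inv_mul_cancel,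
      map_one, one_mul]
  · intro f f' h h'
    simp [h, h']
  · intro f h
    simp [h]

variable [Finite G]

theorem MonPair.inner_add (P : MonPair p G) (f g : G → PadicAlgCl p) :
    P.inner (f + g) = P.inner f + P.inner g := by
  have := Fintype.ofFinite P.U
  simp only [MonPair.inner, finsum_eq_sum_of_fintype, Pi.add_apply, mul_add,
    Finset.sum_add_distrib]

theorem MonPair.inner_neg (P : MonPair p G) (f : G → PadicAlgCl p) :
    P.inner (-f) = -P.inner f := by
  have := Fintype.ofFinite P.U
  simp only [MonPair.inner, finsum_eq_sum_of_fintype, Pi.neg_apply, mul_neg,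
    Finset.sum_neg_distrib]

theorem MonPair.inner_zero (P : MonPair p G) : P.inner (0 : G → PadicAlgCl p) = 0 := by
  have := Fintype.ofFinite P.U
  simp [MonPair.inner]

theorem MonPair.inner_smul (g : G) (P : MonPair p G) {ρ : G → PadicAlgCl p}
    (hρ : ∀ g x, ρ (g * x * g⁻¹) = ρ x) : (g • P).inner ρ = P.inner ρ := by
  have := Fintype.ofFinite P.U
  have := Fintype.ofFinite (g • P).U
  let e : P.U ≃* (g • P).U := (MulAut.conj g).subgroupMap P.U
  have hφ : ∀ u, (g • P).φ (e u) = P.φ u := fun u => congrArg P.φ (e.symm_apply_apply u)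
  simp only [MonPair.inner, finsum_eq_sum_of_fintype]
  rw [Nat.card_congr e.toEquiv, ← e.toEquiv.sum_comp]
  congr 1
  refine Finset.sum_congr rfl fun u _ => ?_
  change (((g • P).φ (e u)⁻¹ : Zbar p) : PadicAlgCl p) * ρ (e u) = _
  rw [← map_inv, hφ]
  congr 1
  exact hρ g u

open Classical in
/-- The sum `∑ μ(P, Q) ⟨Q, ρ⟩` over the pairs `Q ≥ P`. -/
def moebiusSum (ρ : G → PadicAlgCl p) (P : MonPair p G) : PadicAlgCl p :=
  ∑ Q : MonPair p G with P ≤ Q, (IncidenceAlgebra.mu ℤ P Q : PadicAlgCl p) * Q.inner ρ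

open Classical in
theorem brauerCoeff_eq (ρ : G → PadicAlgCl p) (P : MonPair p G) :
    brauerCoeff ρ P = (Nat.card P.U : PadicAlgCl p) / (Nat.card G : PadicAlgCl p) *
      ∑ Q : MonPair p G with ∃ g, Q = P.conj g, moebiusSum ρ Q := rfl

/-- A common form for conjugation, twisting and the Galois action: each permutes the pairs by an
order automorphism `e`, and `σ` fixes the integers `μ`. -/
theorem moebiusSum_orderIso (e : MonPair p G ≃o MonPair p G) (σ : PadicAlgCl p →+* PadicAlgCl p)
    {ρ ρ' : G → PadicAlgCl p} (h : ∀ P, (e P).inner ρ' = σ (P.inner ρ)) (P : MonPair p G) :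
    moebiusSum ρ' (e P) = σ (moebiusSum ρ P) := by
  classical
  rw [moebiusSum, moebiusSum, map_sum]
  symm
  refine Finset.sum_equiv e.toEquiv (fun Q => by simp) fun Q _ => ?_
  rw [map_mul, map_intCast, ← h]
  congr 2
  exact (mu_orderIso e P Q).symm

theorem brauerCoeff_orderIso (e : MonPair p G ≃o MonPair p G)
    (σ : PadicAlgCl p →+* PadicAlgCl p) {ρ ρ' : G → PadicAlgCl p}
    (h : ∀ P, (e P).inner ρ' = σ (P.inner ρ)) (hU : ∀ P, (e P).U = P.U)
    (he : ∀ g P, e (P.conj g) = (e P).conj g) (P : MonPair p G) :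
    brauerCoeff ρ' (e P) = σ (brauerCoeff ρ P) := by
  classical
  rw [brauerCoeff_eq, brauerCoeff_eq, map_mul, map_div₀, map_natCast, map_natCast, map_sum, hU]
  congr 1
  symm
  refine Finset.sum_equiv e.toEquiv (fun Q => ?_) fun Q _ => (moebiusSum_orderIso e σ h Q).symm
  simp [← he]

theorem moebiusSum_smul {ρ : G → PadicAlgCl p} (hρ : ∀ g x, ρ (g * x * g⁻¹) = ρ x)
    (g : G) (P : MonPair p G) : moebiusSum ρ (g • P) = moebiusSum ρ P :=
  moebiusSum_orderIso (MonPair.conjIso g) (RingHom.id _) (fun P => P.inner_smul g hρ) P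

theorem brauerCoeff_add (f g : G → PadicAlgCl p) (P : MonPair p G) :
    brauerCoeff (f + g) P = brauerCoeff f P + brauerCoeff g P := by
  simp only [brauerCoeff, MonPair.inner_add, mul_add, Finset.sum_add_distrib]

theorem brauerCoeff_neg (f : G → PadicAlgCl p) (P : MonPair p G) :
    brauerCoeff (-f) P = -brauerCoeff f P := by
  simp only [brauerCoeff, MonPair.inner_neg, mul_neg, Finset.sum_neg_distrib]

theorem brauerCoeff_zero (P : MonPair p G) :
    brauerCoeff (0 : G → PadicAlgCl p) P = 0 := by
  simp [brauerCoeff, MonPair.inner_zero]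

/-- The class of `P` has `|G|/|Stab(P)|` members, all with the same Möbius sum, so the prefactor
`|U|/|G|` turns into `1/t`. -/
theorem brauerCoeff_eq_of_card {ρ : G → PadicAlgCl p} (hρ : ∀ g x, ρ (g * x * g⁻¹) = ρ x)
    (P : MonPair p G) {t : ℕ} (ht : Nat.card (MulAction.stabilizer G P) = t * Nat.card P.U) :
    t * brauerCoeff ρ P = moebiusSum ρ P := by
  classical
  have h1 : ∀ Q ∈ Finset.univ.filter (fun Q : MonPair p G => ∃ g, Q = P.conj g),
      moebiusSum ρ Q = moebiusSum ρ P := by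
    intro Q hQ
    obtain ⟨g, rfl⟩ := (Finset.mem_filter.1 hQ).2
    exact moebiusSum_smul hρ g P
  rw [brauerCoeff_eq, Finset.sum_congr rfl h1, Finset.sum_const, nsmul_eq_mul]
  have h2 : (Finset.univ.filter (fun Q : MonPair p G => ∃ g, Q = P.conj g)).card *
      (t * Nat.card P.U) = Nat.card G := by
    rw [← ht, ← Subgroup.index_mul_card (MulAction.stabilizer G P)]
    congr 1
    rw [MulAction.index_stabilizer, ← Set.ncard_coe_finset]
    congr 1
    ext Q
    simp only [Finset.coe_filter, Finset.mem_univ, true_and, Set.mem_ofPred_eq,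
      MulAction.mem_orbit_iff, MonPair.smul_def]
    exact exists_congr fun g => eq_comm
  have h3 : (Nat.card G : PadicAlgCl p) ≠ 0 := by exact_mod_cast Nat.card_pos.ne'
  rw [← h2] at h3 ⊢
  push_cast at h3 ⊢
  have h4 := left_ne_zero_of_mul h3
  have h5 := right_ne_zero_of_mul h3
  field_simp
  exact mul_div_cancel_left₀ _ h5

/-- Integrality of the coefficients of explicit Brauer induction. -/
theorem exists_intCast_eq_brauerCoeff [TopologicalSpace G] (ρ : VChar p G) (P : MonPair p G) :
    ∃ z : ℤ, (z : PadicAlgCl p) = brauerCoeff ρ.1 P := by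
  classical
  -- Integrality is preserved by sums and negatives, so only characters of representations need the
  -- counting argument.
  refine VChar.induction (motive := fun f => ∃ z : ℤ, (z : PadicAlgCl p) = brauerCoeff f P)
    ?_ ⟨0, by rw [brauerCoeff_zero, Int.cast_zero]⟩ ?_ ?_ ρ
  · intro f hf
    have hconj : ∀ g x, f (g * x * g⁻¹) = f x :=
      VChar.apply_conj ⟨f, AddSubgroup.subset_closure hf⟩
    obtain ⟨n, r, -, hr⟩ := hf
    obtain rfl : f = fun g => (r g).trace := funext hr
    obtain ⟨k, _, _, s, φ, h1, h2, h3⟩ := exists_reduction r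
    have hle : P.U ≤ MulAction.stabilizer G P := fun u hu => MonPair.smul_eq_self_of_mem hu
    obtain ⟨t, ht⟩ := Subgroup.card_dvd_of_le hle
    rw [mul_comm] at ht
    have h4 : ∑ Q : MonPair p G with P ≤ Q, (IncidenceAlgebra.mu ℤ P Q : PadicAlgCl p) *
        (finrank k (Q.weightSpace s φ) : PadicAlgCl p) = moebiusSum (fun g => (r g).trace) P :=
      Finset.sum_congr rfl fun Q _ => by rw [h3]
    obtain ⟨z, hz⟩ := dvd_sum_mu_mul_finrank (s := s) h1 h2 P ht
    have ht0 : (t : PadicAlgCl p) ≠ 0 := by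
      intro h
      rw [Nat.cast_eq_zero.1 h, zero_mul] at ht
      exact Nat.card_pos.ne' ht
    refine ⟨z, mul_left_cancel₀ ht0 ?_⟩
    rw [brauerCoeff_eq_of_card hconj P ht, ← h4]
    exact_mod_cast hz.symm
  · rintro f g ⟨a, ha⟩ ⟨b, hb⟩
    exact ⟨a + b, by rw [brauerCoeff_add, ← ha, ← hb, Int.cast_add]⟩
  · rintro f ⟨a, ha⟩
    exact ⟨-a, by rw [brauerCoeff_neg, ← ha, Int.cast_neg]⟩

theorem brauerCoeff_smul (ρ : G → PadicAlgCl p) (g : G) (P : MonPair p G) :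
    brauerCoeff ρ (g • P) = brauerCoeff ρ P := by
  classical
  have h1 : Nat.card (g • P).U = Nat.card P.U :=
    (Nat.card_congr ((MulAut.conj g).subgroupMap P.U).toEquiv).symm
  rw [brauerCoeff_eq, brauerCoeff_eq, h1]
  congr 2
  ext Q
  simp only [Finset.mem_filter, Finset.mem_univ, true_and, ← MonPair.smul_def, smul_smul]
  exact ⟨fun ⟨x, hx⟩ => ⟨_, hx⟩, fun ⟨x, hx⟩ => ⟨x * g⁻¹, by simpa using hx⟩⟩

/-- Each integral class coefficient is put on one chosen pair of the class, with zero on the other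
members. -/
theorem exists_represents [TopologicalSpace G] (ρ : VChar p G) :
    ∃ c : MonPair p G →₀ ℤ, Represents c ρ.1 := by
  classical
  choose z hz using exists_intCast_eq_brauerCoeff ρ
  let rep : MonPair p G → MonPair p G := fun P =>
    (Quotient.mk (MulAction.orbitRel G (MonPair p G)) P).out
  have hrep : ∀ P, ∃ g : G, g • P = rep P := fun P => Quotient.mk_out (s := MulAction.orbitRel G _) P
  have hrep' : ∀ (g : G) P, rep (g • P) = rep P := fun g P =>
    congrArg Quotient.out (Quotient.sound (s := MulAction.orbitRel G _) ⟨g, rfl⟩)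
  refine ⟨Finsupp.equivFunOnFinite.symm fun P => if rep P = P then z P else 0, fun P => ?_⟩
  obtain ⟨g, hg⟩ := hrep P
  rw [Finset.sum_eq_single (rep P)]
  · have : rep (rep P) = rep P := by rw [← hg, hrep', hg]
    rw [Finsupp.coe_equivFunOnFinite_symm, if_pos this, hz, ← hg, brauerCoeff_smul]
  · intro Q hQ hne
    obtain ⟨x, rfl⟩ := (Finset.mem_filter.1 hQ).2
    rw [Finsupp.coe_equivFunOnFinite_symm, if_neg]
    rw [← MonPair.smul_def, hrep']
    exact fun h => hne h.symm
  · intro h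
    exact absurd (Finset.mem_filter.2 ⟨Finset.mem_univ _, g, hg.symm⟩) h

end Integrality

/-! ### Composition of twisted maps between completed group algebras -/

section TwistMap

variable {R S T : Type*} [CommRing R] [CommRing S] [CommRing T]
variable {A B C : Type*} [CommGroup A] [TopologicalSpace A] [CommGroup B] [TopologicalSpace B]
  [CommGroup C] [TopologicalSpace C]

theorem transition_refl (M : Subgroup A) (h : M ≤ M) (x : MonoidAlgebra R (A ⧸ M)) :
    transition R h x = x := by
  induction x using MonoidAlgebra.induction_linear with
  | zero => simp only [map_zero]
  | add x y hx hy => simp only [map_add, hx, hy]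
  | single a r =>
    obtain ⟨a, rfl⟩ := QuotientGroup.mk_surjective a
    simp only [transition, MonoidAlgebra.mapDomainRingHom_apply, MonoidAlgebra.mapDomain_single]
    rfl

/-- The level `π⁻¹(M) ∩ ker χ` of the definition may be replaced by any smaller open subgroup, so
that several maps can be compared at a common level. -/
theorem twistMap_apply (f : R →+* S) (π : A →* B) (hπ : Continuous π) (χ : A →* Sˣ)
    (hχ : IsOpen (χ.ker : Set A)) (x : IwasawaAlgebra R A) (N : OpenSubgroup A)
    (M : OpenSubgroup B) (h1 : (N : Subgroup A) ≤ (M : Subgroup B).comap π)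
    (h2 : (N : Subgroup A) ≤ χ.ker) :
    (twistMap f π hπ χ hχ x).1 M = twistLevel f π χ N M h1 h2 (x.1 N) := by
  have hN : (N : Subgroup A) ≤ (twistSource π hπ χ hχ M : Subgroup A) :=
    fun a ha => And.intro (h1 ha) (h2 ha)
  change twistLevel f π χ _ _ (twistSource_le_comap π hπ χ hχ M)
    (twistSource_le_ker π hπ χ hχ M) (x.1 (twistSource π hπ χ hχ M)) = _
  rw [← x.2 _ _ hN, ← transition_twistLevel f π χ _ _ _ _ h1 h2 _ _ hN le_rfl, transition_refl]

/-- At a common finite level both sides are additive and agree on the elements `r · [a]`. The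
relations between `Tw`, the Galois action, `Det` and conjugation are instances. -/
theorem twistMap_twistMap {f : R →+* S} {π : A →* B} {hπ : Continuous π} {χ : A →* Sˣ}
    {hχ : IsOpen (χ.ker : Set A)} {f' : S →+* T} {π' : B →* C} {hπ' : Continuous π'}
    {χ' : B →* Tˣ} {hχ' : IsOpen (χ'.ker : Set B)} {f'' : R →+* T} {π'' : A →* C}
    {hπ'' : Continuous π''} {χ'' : A →* Tˣ} {hχ'' : IsOpen (χ''.ker : Set A)}
    (hf : ∀ r, f'' r = f' (f r)) (h : ∀ a, π'' a = π' (π a))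
    (hc : ∀ a, (χ'' a : T) = f' (χ a) * χ' (π a)) (x : IwasawaAlgebra R A) :
    twistMap f' π' hπ' χ' hχ' (twistMap f π hπ χ hχ x) = twistMap f'' π'' hπ'' χ'' hχ'' x := by
  apply Subtype.ext
  funext L
  let M := twistSource π' hπ' χ' hχ' L
  let N := twistSource π hπ χ hχ M ⊓ twistSource π'' hπ'' χ'' hχ'' L
  have hN1 : (N : Subgroup A) ≤ twistSource π hπ χ hχ M := fun _ ha => And.left ha
  have hN2 : (N : Subgroup A) ≤ twistSource π'' hπ'' χ'' hχ'' L := fun _ ha => And.right ha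
  rw [twistMap_apply f' π' hπ' χ' hχ' _ M L (twistSource_le_comap ..) (twistSource_le_ker ..),
    twistMap_apply f π hπ χ hχ x N M (hN1.trans (twistSource_le_comap ..))
      (hN1.trans (twistSource_le_ker ..)),
    twistMap_apply f'' π'' hπ'' χ'' hχ'' x N L (hN2.trans (twistSource_le_comap ..))
      (hN2.trans (twistSource_le_ker ..))]
  induction x.1 N using MonoidAlgebra.induction_linear with
  | zero => simp only [map_zero]
  | add x y hx hy => simp only [map_add, hx, hy]
  | single a r =>
    obtain ⟨a, rfl⟩ := QuotientGroup.mk_surjective a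
    rw [twistLevel_single, twistLevel_single, twistLevel_single, h, hc, hf, map_mul, mul_assoc]

end TwistMap

/-! ### Twists and Galois action on the values of `Det` -/

section Lambda

variable {p : ℕ} [Fact p.Prime]

/-- The action of `σ ∈ Gal(ℚ̄_p/ℚ_p)` on characters with open kernel. -/
def FinChar.gal {A : Type*} [Group A] [TopologicalSpace A] [IsTopologicalGroup A]
    (σ : PadicAlgCl p ≃ₐ[ℚ_[p]] PadicAlgCl p) (χ : FinChar p A) : FinChar p A :=
  ⟨(Units.map (galZbar p σ : Zbar p →* Zbar p)).comp χ.1,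
    Subgroup.isOpen_mono (H₁ := χ.1.ker) (fun a ha => by
      have h : χ.1 a = 1 := ha
      simp [MonoidHom.mem_ker, h]) χ.2⟩

variable {Γ : Type*} [CommGroup Γ] [TopologicalSpace Γ] [IsTopologicalGroup Γ] [CompactSpace Γ]

theorem Tw_Tw (φ ψ : FinChar p Γ) (x : LambdaZbar p Γ) : Tw φ (Tw ψ x) = Tw (φ * ψ) x :=
  Subtype.ext (twistMap_twistMap (fun _ => rfl) (fun _ => rfl)
    (fun _ => mul_comm _ _) x.1)

theorem galLambda_Tw (σ : PadicAlgCl p ≃ₐ[ℚ_[p]] PadicAlgCl p) (φ : FinChar p Γ)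
    (x : LambdaZbar p Γ) : galLambda σ (Tw φ x) = Tw (FinChar.gal σ φ) (galLambda σ x) := by
  refine Subtype.ext ((twistMap_twistMap (f'' := galZbar p σ) (π'' := MonoidHom.id Γ)
    (hπ'' := continuous_id) (χ'' := (FinChar.gal σ φ).1) (hχ'' := (FinChar.gal σ φ).2) (fun _ => rfl)
    (fun _ => rfl) (fun _ => ?_) x.1).trans
    (twistMap_twistMap (fun _ => rfl) (fun _ => rfl) (fun _ => ?_) x.1).symm)
  · exact (mul_one _).symm
  · exact (one_mul _).symm

variable [T1Space Γ] {U : Type*} [Group U] [TopologicalSpace U] [IsTopologicalGroup U]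
  [CompactSpace U]

theorem Tw_det (φ : FinChar p Γ) (π : U →* Γ) (hπ : Continuous π) (χ χ' : FinChar p U)
    (h : ∀ u, χ'.1 u = φ.1 (π u) * χ.1 u)
    (x : IwasawaAlgebra ℤ_[p] (TopologicalAbelianization U)) :
    Tw φ (det π hπ χ x) = det π hπ χ' x := by
  refine Subtype.ext (twistMap_twistMap (fun _ => rfl) (fun _ => rfl) (fun a => ?_) x)
  obtain ⟨a, rfl⟩ := QuotientGroup.mk_surjective a
  change ((χ'.1 a : (Zbar p)ˣ) : Zbar p) = χ.1 a * φ.1 (π a)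
  rw [h, Units.val_mul, mul_comm]

theorem galLambda_det (σ : PadicAlgCl p ≃ₐ[ℚ_[p]] PadicAlgCl p) (π : U →* Γ) (hπ : Continuous π)
    (χ : FinChar p U) (x : IwasawaAlgebra ℤ_[p] (TopologicalAbelianization U)) :
    galLambda σ (det π hπ χ x) = det π hπ (FinChar.gal σ χ) x := by
  refine Subtype.ext (twistMap_twistMap (fun r => ?_) (fun _ => rfl) (fun a => ?_) x)
  · exact Subtype.ext (σ.commutes (r : ℚ_[p])).symm
  · obtain ⟨a, rfl⟩ := QuotientGroup.mk_surjective a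
    change galZbar p σ (χ.1 a) = galZbar p σ (χ.1 a) * 1
    rw [mul_one]

end Lambda

/-! ### Conjugation invariance of the factors -/

section Conj

variable {p : ℕ} [Fact p.Prime]
variable {𝒢 : Type*} [Group 𝒢] [TopologicalSpace 𝒢] [IsTopologicalGroup 𝒢] [CompactSpace 𝒢]
variable {Γ : Type*} [CommGroup Γ] [TopologicalSpace Γ] [IsTopologicalGroup Γ] [CompactSpace Γ]
  [T1Space Γ] {𝒵 : OpenNormalSubgroup 𝒢}

/-- As `Γ` is commutative, `ω` does not see conjugation, and only the character has to be
transported. -/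
theorem det_conjLambda (ω : 𝒢 →* Γ) (hω : Continuous ω) (g : 𝒢) (U : SubgroupsOver 𝒵)
    (χ : FinChar p U.1) (χ' : FinChar p (U.conj g).1) (h : ∀ u, χ'.1 (conjHom g U u) = χ.1 u)
    (x : IwasawaAlgebra ℤ_[p] (TopologicalAbelianization U.1)) :
    det (ω.comp (U.conj g).1.subtype) (hω.comp continuous_subtype_val) χ' (conjLambda p g U x) =
      det (ω.comp U.1.subtype) (hω.comp continuous_subtype_val) χ x := by
  refine Subtype.ext (twistMap_twistMap (fun _ => rfl) (fun a => ?_) (fun a => ?_) x)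
  · obtain ⟨a, rfl⟩ := QuotientGroup.mk_surjective a
    change ω a = ω (g * a * g⁻¹)
    simp
  · obtain ⟨a, rfl⟩ := QuotientGroup.mk_surjective a
    change ((χ.1 a : (Zbar p)ˣ) : Zbar p) =
      algebraMap ℤ_[p] (Zbar p) ((1 : ℤ_[p]ˣ) : ℤ_[p]) * (χ'.1 (conjHom g U a))
    rw [h, Units.val_one, map_one, one_mul]

/-- The conjugate enters as a variable `V` with an equation, since the preimage of a conjugate pair
is the conjugate of the preimage only up to a propositional equality, and `x_V` depends on `V`. -/
theorem det_conj (ω : 𝒢 →* Γ) (hω : Continuous ω) (x : InvTuples p 𝒵) (g : 𝒢)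
    (U V : SubgroupsOver 𝒵) (χ : FinChar p U.1) (ψ : FinChar p V.1) (hV : V = U.conj g)
    (h : ∀ (u : U.1) (hu : g * (u : 𝒢) * g⁻¹ ∈ V.1), ψ.1 ⟨_, hu⟩ = χ.1 u) :
    det (ω.comp V.1.subtype) (hω.comp continuous_subtype_val) ψ (x.1 V).val =
      det (ω.comp U.1.subtype) (hω.comp continuous_subtype_val) χ (x.1 U).val := by
  subst hV
  rw [← det_conjLambda ω hω g U χ ψ (fun u => h u (conjHom g U u).2)]
  exact congrArg (fun y => det (ω.comp (U.conj g).1.subtype) (hω.comp continuous_subtype_val) ψ y)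
    (congrArg Units.val (x.2 g U)).symm

theorem preimage_smul (P : MonPair p (𝒢 ⧸ 𝒵.toSubgroup)) (g : 𝒢) :
    ((g : 𝒢 ⧸ 𝒵.toSubgroup) • P).preimage = P.preimage.conj g := by
  apply Subtype.ext
  ext y
  change (y : 𝒢 ⧸ 𝒵.toSubgroup) ∈ (P.conj _).U ↔ _
  rw [MonPair.mem_conj]
  constructor
  · intro h
    exact ⟨g⁻¹ * y * g, h, by simp [mul_assoc]⟩
  · rintro ⟨z, hz, rfl⟩
    have : ((g⁻¹ * (MulAut.conj g z) * g : 𝒢) : 𝒢 ⧸ 𝒵.toSubgroup) ∈ P.U := by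
      simpa [mul_assoc] using! hz
    exact this

/-- Conjugate pairs of `𝒢/𝒵` give the same factor for an invariant tuple. -/
theorem det_smul (ω : 𝒢 →* Γ) (hω : Continuous ω) (x : InvTuples p 𝒵)
    (P : MonPair p (𝒢 ⧸ 𝒵.toSubgroup)) (g : 𝒢 ⧸ 𝒵.toSubgroup) :
    det (ω.comp (g • P).preimage.1.subtype) (hω.comp continuous_subtype_val) (g • P).inflChar
        (x.1 (g • P).preimage).val =
      det (ω.comp P.preimage.1.subtype) (hω.comp continuous_subtype_val) P.inflChar
        (x.1 P.preimage).val := by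
  obtain ⟨g, rfl⟩ := QuotientGroup.mk_surjective g
  refine det_conj ω hω x g _ _ _ _ (preimage_smul P g) fun u hu => ?_
  have hu' : ((g * u * g⁻¹ : 𝒢) : 𝒢 ⧸ 𝒵.toSubgroup) ∈ (P.conj (g : 𝒢 ⧸ 𝒵.toSubgroup)).U := hu
  have h1 : (P.conj (g : 𝒢 ⧸ 𝒵.toSubgroup)).φ ⟨_, hu'⟩ =
      P.φ ⟨((u : 𝒢) : 𝒢 ⧸ 𝒵.toSubgroup), u.2⟩ := by
    rw [MonPair.conj_φ]
    refine MonPair.φ_congr ?_ _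
    rw [← QuotientGroup.mk_inv, ← QuotientGroup.mk_mul, ← QuotientGroup.mk_mul]
    simp [mul_assoc]
  exact h1

end Conj

/-! ### Twisting and Galois action on pairs and on representing tuples -/

section PairMaps

variable {p : ℕ} [Fact p.Prime] {G : Type*} [Group G]

/-- Multiplication of the characters of pairs by a character of the group. -/
def MonPair.twistIso (η : G →* (Zbar p)ˣ) : MonPair p G ≃o MonPair p G where
  toFun P := ⟨P.U, η.comp P.U.subtype * P.φ⟩
  invFun P := ⟨P.U, (η.comp P.U.subtype)⁻¹ * P.φ⟩
  left_inv P := MonPair.ext rfl (heq_of_eq (MonoidHom.ext fun u =>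
    inv_mul_cancel_left (η u) (P.φ u)))
  right_inv P := MonPair.ext rfl (heq_of_eq (MonoidHom.ext fun u =>
    mul_inv_cancel_left (η u) (P.φ u)))
  map_rel_iff' {P Q} := by
    rw [MonPair.le_iff, MonPair.le_iff]
    refine forall₂_congr fun g hg => exists_congr fun h => ?_
    change η g * Q.φ ⟨g, h⟩ = η g * P.φ ⟨g, hg⟩ ↔ _
    exact mul_right_inj _

theorem galZbar_symm_apply (σ : PadicAlgCl p ≃ₐ[ℚ_[p]] PadicAlgCl p) (x : Zbar p) :
    galZbar p σ (galZbar p σ.symm x) = x := Subtype.ext (σ.apply_symm_apply x)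

theorem galZbar_injective (σ : PadicAlgCl p ≃ₐ[ℚ_[p]] PadicAlgCl p) :
    Function.Injective (galZbar p σ) :=
  fun _ _ h => Subtype.ext (σ.injective (congrArg Subtype.val h))

/-- The action of `σ ∈ Gal(ℚ̄_p/ℚ_p)` on the characters of pairs. -/
def MonPair.galIso (σ : PadicAlgCl p ≃ₐ[ℚ_[p]] PadicAlgCl p) : MonPair p G ≃o MonPair p G where
  toFun P := ⟨P.U, (Units.map (galZbar p σ : Zbar p →* Zbar p)).comp P.φ⟩
  invFun P := ⟨P.U, (Units.map (galZbar p σ.symm : Zbar p →* Zbar p)).comp P.φ⟩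
  left_inv P := MonPair.ext rfl (heq_of_eq (MonoidHom.ext fun _ =>
    Units.ext (galZbar_symm_apply σ.symm _)))
  right_inv P := MonPair.ext rfl (heq_of_eq (MonoidHom.ext fun _ =>
    Units.ext (galZbar_symm_apply σ _)))
  map_rel_iff' {P Q} := by
    rw [MonPair.le_iff, MonPair.le_iff]
    refine forall₂_congr fun g hg => exists_congr fun h => ?_
    change Units.map _ (Q.φ ⟨g, h⟩) = Units.map _ (P.φ ⟨g, hg⟩) ↔ _
    exact (Units.map_injective (galZbar_injective σ)).eq_iff

theorem MonPair.twistIso_conj (η : G →* (Zbar p)ˣ) (g : G) (P : MonPair p G) :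
    MonPair.twistIso η (P.conj g) = (MonPair.twistIso η P).conj g := by
  change (⟨_, _⟩ : MonPair p G) = ⟨_, _⟩
  congr 1
  ext1 ⟨u, hu⟩
  change η u * (P.conj g).φ ⟨u, hu⟩ = η _ * P.φ _
  rw [MonPair.conj_φ]
  congr 1
  change η u = η (g⁻¹ * u * g)
  rw [map_mul, map_mul, map_inv, mul_comm, mul_inv_cancel_left]

theorem MonPair.galIso_conj (σ : PadicAlgCl p ≃ₐ[ℚ_[p]] PadicAlgCl p) (g : G) (P : MonPair p G) :
    MonPair.galIso σ (P.conj g) = (MonPair.galIso σ P).conj g := rfl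

variable [Finite G]

theorem MonPair.twistIso_inner (η : G →* (Zbar p)ˣ) (P : MonPair p G) (ρ : G → PadicAlgCl p) :
    (MonPair.twistIso η P).inner (fun g => ((η g : Zbar p) : PadicAlgCl p) * ρ g) =
      P.inner ρ := by
  refine congrArg (_ * ·) (finsum_congr fun u => ?_)
  change (((η (u : G)⁻¹ * P.φ u⁻¹ : (Zbar p)ˣ) : Zbar p) : PadicAlgCl p) *
    (((η u : Zbar p) : PadicAlgCl p) * ρ u) = _
  have h : (((η (u : G)⁻¹ : (Zbar p)ˣ) : Zbar p) : PadicAlgCl p) * ((η u : Zbar p) : PadicAlgCl p)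
      = 1 := by
    rw [← Subalgebra.coe_mul, ← Units.val_mul, ← map_mul]
    simp
  rw [Units.val_mul, Subalgebra.coe_mul]
  linear_combination (((P.φ u⁻¹ : (Zbar p)ˣ) : Zbar p) : PadicAlgCl p) * ρ u * h

theorem MonPair.galIso_inner (σ : PadicAlgCl p ≃ₐ[ℚ_[p]] PadicAlgCl p) (P : MonPair p G)
    (ρ : G → PadicAlgCl p) :
    (MonPair.galIso σ P).inner (fun g => σ (ρ g)) = σ (P.inner ρ) := by
  have := Fintype.ofFinite P.U
  have h : (MonPair.galIso σ P).inner (fun g => σ (ρ g)) = (Nat.card P.U : PadicAlgCl p)⁻¹ *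
    ∑ᶠ u : P.U, σ ((P.φ u⁻¹ : Zbar p) : PadicAlgCl p) * σ (ρ u) := rfl
  rw [h, MonPair.inner, finsum_eq_sum_of_fintype, finsum_eq_sum_of_fintype, map_mul, map_inv₀,
    map_natCast, map_sum]
  simp only [map_mul]

/-- The automorphism `e` permutes conjugacy classes, and class sums, being integers, are fixed by
`σ`. -/
theorem Represents.equivMapDomain (e : MonPair p G ≃o MonPair p G)
    (σ : PadicAlgCl p →+* PadicAlgCl p) {ρ ρ' : G → PadicAlgCl p}
    (h : ∀ P, (e P).inner ρ' = σ (P.inner ρ)) (hU : ∀ P, (e P).U = P.U)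
    (he : ∀ g P, e (P.conj g) = (e P).conj g) {c : MonPair p G →₀ ℤ} (hc : Represents c ρ) :
    Represents (c.equivMapDomain e.toEquiv) ρ' := by
  classical
  intro Q
  obtain ⟨P, rfl⟩ := e.surjective Q
  rw [brauerCoeff_orderIso e σ h hU he, ← hc P, map_intCast]
  congr 1
  symm
  refine Finset.sum_equiv e.toEquiv (fun Q => ?_) fun Q _ => ?_
  · simp [← he]
  · rw [Finsupp.equivMapDomain_apply, Equiv.symm_apply_apply]

theorem Represents.add {c d : MonPair p G →₀ ℤ} {f g : G → PadicAlgCl p} (hc : Represents c f)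
    (hd : Represents d g) : Represents (c + d) (f + g) := by
  intro P
  rw [brauerCoeff_add, ← hc P, ← hd P, ← Int.cast_add, ← Finset.sum_add_distrib]
  rfl

/-- On a conjugacy class `D` is constant, so the class contributes `D P` to the sum of its
exponents. That sum is the coefficient of the class, the same for both tuples because `ℤ` embeds in
`ℚ̄_p`. -/
theorem prod_zpow_eq_of_represents {M : Type*} [CommGroup M] {D : MonPair p G → M}
    (hD : ∀ (g : G) P, D (g • P) = D P) {c d : MonPair p G →₀ ℤ} {ρ : G → PadicAlgCl p}
    (hc : Represents c ρ) (hd : Represents d ρ) :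
    (c.prod fun P n => D P ^ n) = d.prod fun P n => D P ^ n := by
  classical
  rw [Finsupp.prod_fintype _ _ (fun _ => zpow_zero _), Finsupp.prod_fintype _ _ (fun _ => zpow_zero _),
    ← Finset.prod_fiberwise _ (Quotient.mk (MulAction.orbitRel G (MonPair p G))),
    ← Finset.prod_fiberwise _ (Quotient.mk (MulAction.orbitRel G (MonPair p G)))]
  refine Finset.prod_congr rfl fun q _ => ?_
  obtain ⟨P, rfl⟩ := Quotient.exists_rep q
  have hfil : Finset.univ.filter (fun Q : MonPair p G =>
      Quotient.mk (MulAction.orbitRel G (MonPair p G)) Q = Quotient.mk _ P) =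
      Finset.univ.filter fun Q => ∃ g, Q = P.conj g := by
    ext Q
    simp only [Finset.mem_filter, Finset.mem_univ, true_and]
    rw [Quotient.eq, MulAction.orbitRel_apply, MulAction.mem_orbit_iff]
    exact exists_congr fun g => eq_comm
  have key : ∀ c : MonPair p G →₀ ℤ,
      ∏ Q : MonPair p G with ∃ g, Q = P.conj g, D Q ^ c Q =
        D P ^ ∑ Q : MonPair p G with ∃ g, Q = P.conj g, c Q := by
    intro c
    have hD' : ∀ Q ∈ Finset.univ.filter (fun Q : MonPair p G => ∃ g, Q = P.conj g),
        D Q ^ c Q = D P ^ c Q := by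
      intro Q hQ
      obtain ⟨g, rfl⟩ := (Finset.mem_filter.1 hQ).2
      rw [← MonPair.smul_def, hD]
    rw [Finset.prod_congr rfl hD']
    exact (map_sum (zpowersHom M (D P)).toAdditive _ _).symm
  rw [hfil, key, key]
  congr 1
  exact_mod_cast (hc P).trans (hd P).symm

end PairMaps

/-! ### The product as a function on the virtual characters of `𝒢/𝒵` -/

section Br

variable {p : ℕ} [Fact p.Prime]
variable {𝒢 : Type*} [Group 𝒢] [TopologicalSpace 𝒢] [IsTopologicalGroup 𝒢] [CompactSpace 𝒢]
variable {Γ : Type*} [CommGroup Γ] [TopologicalSpace Γ] [IsTopologicalGroup Γ] [CompactSpace Γ]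
  [T1Space Γ] {𝒵 : OpenNormalSubgroup 𝒢} {ω : 𝒢 →* Γ} {hω : Continuous ω}

variable (ω hω) in
/-- The product attached to an invariant tuple and a virtual character of `𝒢/𝒵`. -/
def brValue (x : InvTuples p 𝒵) (ρ : VChar p (𝒢 ⧸ 𝒵.toSubgroup)) : (LambdaZbar p Γ)ˣ :=
  brProduct ω hω x.1 (exists_represents ρ).choose

variable (ω hω) in
/-- The factor of a pair in the product of an invariant tuple. -/
def detUnit (x : InvTuples p 𝒵) (P : MonPair p (𝒢 ⧸ 𝒵.toSubgroup)) : (LambdaZbar p Γ)ˣ :=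
  Units.map (det (ω.comp P.preimage.1.subtype) (hω.comp continuous_subtype_val)
    P.inflChar).toMonoidHom (x.1 P.preimage)

theorem brProduct_eq (x : InvTuples p 𝒵) (c : MonPair p (𝒢 ⧸ 𝒵.toSubgroup) →₀ ℤ) :
    brProduct ω hω x.1 c = c.prod fun P n => detUnit ω hω x P ^ n := rfl

/-- This frees `brValue` from its chosen tuple; in additivity and equivariance, a tuple adapted to
the situation replaces the chosen one. -/
theorem brProduct_eq_brValue (x : InvTuples p 𝒵) {ρ : VChar p (𝒢 ⧸ 𝒵.toSubgroup)}
    {c : MonPair p (𝒢 ⧸ 𝒵.toSubgroup) →₀ ℤ} (hc : Represents c ρ.1) :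
    brProduct ω hω x.1 c = brValue ω hω x ρ :=
  prod_zpow_eq_of_represents (D := detUnit ω hω x)
    (fun g P => Units.ext (det_smul ω hω x P g)) hc (exists_represents ρ).choose_spec

theorem brValue_add (x : InvTuples p 𝒵) (ρ ρ' : VChar p (𝒢 ⧸ 𝒵.toSubgroup)) :
    brValue ω hω x (ρ + ρ') = brValue ω hω x ρ * brValue ω hω x ρ' := by
  have h := (exists_represents ρ).choose_spec.add (exists_represents ρ').choose_spec
  rw [← brProduct_eq_brValue x (ρ := ρ + ρ') h]
  exact Finsupp.prod_add_index' (fun _ => zpow_zero _) (fun _ _ _ => zpow_add _ _ _)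

theorem brValue_mul (x y : InvTuples p 𝒵) (ρ : VChar p (𝒢 ⧸ 𝒵.toSubgroup)) :
    brValue ω hω (x * y) ρ = brValue ω hω x ρ * brValue ω hω y ρ := by
  have h : ∀ P, detUnit ω hω (x * y) P = detUnit ω hω x P * detUnit ω hω y P :=
    fun P => map_mul _ _ _
  simp only [brValue, brProduct_eq, h, mul_zpow, Finsupp.prod_mul]

/-- The tuple relabelled along `e` represents `ρ'`; reindexing the product along `e` then applies
`τ` to each factor. -/
theorem brValue_orderIso (x : InvTuples p 𝒵) (e : MonPair p (𝒢 ⧸ 𝒵.toSubgroup) ≃o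
      MonPair p (𝒢 ⧸ 𝒵.toSubgroup)) (σ : PadicAlgCl p →+* PadicAlgCl p)
    {ρ ρ' : VChar p (𝒢 ⧸ 𝒵.toSubgroup)}
    (h : ∀ P, (e P).inner ρ'.1 = σ (P.inner ρ.1)) (hU : ∀ P, (e P).U = P.U)
    (he : ∀ g P, e (P.conj g) = (e P).conj g) (τ : LambdaZbar p Γ →+* LambdaZbar p Γ)
    (hτ : ∀ P, detUnit ω hω x (e P) = Units.map τ.toMonoidHom (detUnit ω hω x P)) :
    brValue ω hω x ρ' = Units.map τ.toMonoidHom (brValue ω hω x ρ) := by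
  rw [← brProduct_eq_brValue x
    ((exists_represents ρ).choose_spec.equivMapDomain e σ h hU he), brValue, brProduct_eq,
    brProduct_eq, Finsupp.prod_equivMapDomain, map_finsuppProd]
  refine Finsupp.prod_congr fun P _ => ?_
  rw [map_zpow, ← hτ]
  rfl

theorem brValue_twist (x : InvTuples p 𝒵) (η : FinChar p (𝒢 ⧸ 𝒵.toSubgroup)) (φ : FinChar p Γ)
    (h : ∀ g : 𝒢, η.1 (g : 𝒢 ⧸ 𝒵.toSubgroup) = φ.1 (ω g)) (ρ : VChar p (𝒢 ⧸ 𝒵.toSubgroup)) :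
    brValue ω hω x (VChar.twist η ρ) = Units.map (Tw φ).toMonoidHom (brValue ω hω x ρ) :=
  brValue_orderIso x (MonPair.twistIso η.1) (RingHom.id _)
    (fun P => MonPair.twistIso_inner η.1 P ρ.1) (fun _ => rfl) (MonPair.twistIso_conj η.1) (Tw φ)
    fun P => Units.ext (Tw_det φ _ _ P.inflChar (MonPair.twistIso η.1 P).inflChar
      (fun u => congrArg (· * _) (h u)) _).symm

theorem brValue_gal (x : InvTuples p 𝒵) (σ : PadicAlgCl p ≃ₐ[ℚ_[p]] PadicAlgCl p)
    (ρ : VChar p (𝒢 ⧸ 𝒵.toSubgroup)) :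
    brValue ω hω x (VChar.gal σ ρ) = Units.map (galLambda σ).toMonoidHom (brValue ω hω x ρ) :=
  brValue_orderIso x (MonPair.galIso σ) (σ : PadicAlgCl p →+* PadicAlgCl p)
    (fun P => MonPair.galIso_inner σ P ρ.1) (fun _ => rfl) (MonPair.galIso_conj σ) (galLambda σ)
    fun P => Units.ext (galLambda_det σ _ _ P.inflChar _).symm

end Br

/-! ### Extending characters of the central subgroup to `Γ` -/

section Extension

variable {p : ℕ} [Fact p.Prime]
variable {𝒢 : Type*} [Group 𝒢] [TopologicalSpace 𝒢] [IsTopologicalGroup 𝒢] [CompactSpace 𝒢]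
variable {Γ : Type*} [CommGroup Γ] [TopologicalSpace Γ] [IsTopologicalGroup Γ] [CompactSpace Γ]
  [T2Space Γ] {𝒵 : OpenNormalSubgroup 𝒢} {ω : 𝒢 →* Γ}

/-- An element of `𝒵` in the finite kernel has finite order, and `𝒵 ≅ ℤ_p` is torsion-free. -/
theorem eq_one_of_map_eq_one (hker : Finite ω.ker)
    (h𝒵 : Nonempty (𝒵.toSubgroup ≃ₜ* Multiplicative ℤ_[p])) {z : 𝒢} (hz : z ∈ 𝒵.toSubgroup)
    (h : ω z = 1) : z = 1 := by
  obtain ⟨e⟩ := h𝒵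
  have h1 : IsOfFinOrder (⟨z, h⟩ : ω.ker) := isOfFinOrder_of_finite _
  obtain ⟨n, hn, h2⟩ := isOfFinOrder_iff_pow_eq_one.1 h1
  have h3 : (⟨z, hz⟩ : 𝒵.toSubgroup) ^ n = 1 := Subtype.ext (congrArg (fun y : ω.ker => (y : 𝒢)) h2)
  have h4 : (e ⟨z, hz⟩) ^ n = 1 := by rw [← map_pow, h3, map_one]
  have h5 : n • (Multiplicative.toAdd (e ⟨z, hz⟩)) = 0 := h4
  have h6 : Multiplicative.toAdd (e ⟨z, hz⟩) = 0 := (smul_eq_zero.1 h5).resolve_left hn.ne'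
  have h7 : e ⟨z, hz⟩ = 1 := h6
  have h8 : (⟨z, hz⟩ : 𝒵.toSubgroup) = 1 := e.injective (h7.trans (map_one e).symm)
  exact congrArg Subtype.val h8

/-- A character with open kernel of a subgroup on which `ω` is injective extends to `Γ`. -/
theorem exists_finChar_extending (hω : Continuous ω) (hsurj : Function.Surjective ω)
    (hinj : ∀ z ∈ 𝒵.toSubgroup, ω z = 1 → z = 1) (ψ : 𝒵.toSubgroup →* (Zbar p)ˣ)
    (hψ : IsOpen (ψ.ker : Set 𝒵.toSubgroup)) :
    ∃ χ : FinChar p Γ, ∀ z : 𝒵.toSubgroup, χ.1 (ω z) = ψ z := by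
  -- Passing to a finite quotient of `Γ`: `ker ψ` is open in `𝒢`, and its image `H` is compact of
  -- finite index, hence open in `Γ`.
  let K : Subgroup 𝒢 := ψ.ker.map 𝒵.toSubgroup.subtype
  have hK : IsOpen (K : Set 𝒢) := 𝒵.isOpen'.isOpenMap_subtype_val _ hψ
  have : K.FiniteIndex := by
    have := Subgroup.quotient_finite_of_isOpen K hK
    exact Subgroup.finiteIndex_of_finite_quotient
  let H : Subgroup Γ := K.map ω
  have hHc : IsClosed (H : Set Γ) :=
    ((Subgroup.isClosed_of_isOpen K hK).isCompact.image hω).isClosed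
  have hHfi : H.FiniteIndex := ⟨fun h => by
    have h1 := Subgroup.index_map_dvd K hsurj
    rw [h, zero_dvd_iff] at h1
    exact Subgroup.FiniteIndex.index_ne_zero h1⟩
  have hHo : IsOpen (H : Set Γ) := Subgroup.isOpen_of_isClosed_of_finiteIndex H hHc
  have hfin : Finite (Γ ⧸ H) := inferInstance
  let q : 𝒵.toSubgroup →* Γ ⧸ H := (QuotientGroup.mk' H).comp (ω.comp 𝒵.toSubgroup.subtype)
  -- Injectivity of `ω` on `𝒵` shows that an element of `𝒵` mapped into `H = ω(ker ψ)` lies in `ker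
  -- ψ`, so `ψ` descends to the image of `𝒵` in `Γ/H`.
  have hq : q.rangeRestrict.ker ≤ ψ.ker := by
    intro z hz
    rw [MonoidHom.ker_rangeRestrict] at hz
    obtain ⟨_, ⟨z', hz', rfl⟩, h⟩ := (QuotientGroup.eq_one_iff _).1 hz
    have h1 : (z' : 𝒢)⁻¹ * z = 1 := hinj _ (𝒵.toSubgroup.mul_mem (𝒵.toSubgroup.inv_mem z'.2) z.2) (by
      rw [map_mul, map_inv]
      exact inv_mul_eq_one.2 h)
    have h2 : z' = z := Subtype.ext (inv_mul_eq_one.1 h1)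
    exact h2 ▸ hz'
  let ψ' : q.range →* (Zbar p)ˣ :=
    q.rangeRestrict.liftOfSurjective q.rangeRestrict_surjective ⟨ψ, hq⟩
  have hψ' : ∀ z, ψ' (q.rangeRestrict z) = ψ z := fun z =>
    MonoidHom.liftOfRightInverse_comp_apply _ _ _ ⟨ψ, hq⟩ z
  have : NeZero (Monoid.exponent (Γ ⧸ H)) := ⟨Monoid.exponent_ne_zero_of_finite⟩
  have := hasEnoughRootsOfUnity_Zbar p (Monoid.exponent (Γ ⧸ H))
  -- Characters of a subgroup of a finite abelian group extend, since `ℤ̄_p` has enough roots of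
  -- unity.
  obtain ⟨θ, hθ⟩ := MonoidHom.domRestrict_surjective (Zbar p) q.range ψ'
  refine ⟨⟨θ.comp (QuotientGroup.mk' H), Subgroup.isOpen_mono (H₁ := H) (fun a ha => ?_) hHo⟩,
    fun z => ?_⟩
  · have : QuotientGroup.mk' H a = 1 := (QuotientGroup.eq_one_iff _).2 ha
    rw [MonoidHom.mem_ker, MonoidHom.comp_apply, this, map_one]
  · rw [← hψ', ← hθ]
    rfl

end Extension

/-! ### Twisted inflations of virtual characters of `𝒢/𝒵` -/

section Generation

variable {p : ℕ} [Fact p.Prime]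
variable {𝒢 : Type*} [Group 𝒢] [TopologicalSpace 𝒢] [IsTopologicalGroup 𝒢]
variable {Γ : Type*} [CommGroup Γ] [TopologicalSpace Γ] [IsTopologicalGroup Γ]
  {𝒵 : OpenNormalSubgroup 𝒢} {ω : 𝒢 →* Γ} {hω : Continuous ω}

/-- The inflation of virtual characters of `𝒢/𝒵` to `𝒢`. -/
def VChar.infl (ρ : VChar p (𝒢 ⧸ 𝒵.toSubgroup)) : VChar p 𝒢 :=
  ⟨fun g => ρ.1 (g : 𝒢 ⧸ 𝒵.toSubgroup), by
    refine VChar.induction (motive := fun f => (fun g : 𝒢 => f (g : 𝒢 ⧸ 𝒵.toSubgroup)) ∈ VChar p 𝒢)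
      ?_ (VChar p 𝒢).zero_mem (fun _ _ h1 h2 => (VChar p 𝒢).add_mem h1 h2)
      (fun _ h => (VChar p 𝒢).neg_mem h) ρ
    rintro f ⟨n, r, hr, hf⟩
    exact AddSubgroup.subset_closure ⟨n, r.comp (QuotientGroup.mk' 𝒵.toSubgroup),
      hr.preimage QuotientGroup.continuous_mk, fun g => hf g⟩⟩

variable (ω hω) in
/-- The virtual character `(χ⁻¹ ∘ ω) · ρ` of `𝒢`, for a virtual character `ρ` of `𝒢/𝒵`. -/
def VChar.twistInfl (χ : FinChar p Γ) : VChar p (𝒢 ⧸ 𝒵.toSubgroup) →+ VChar p 𝒢 where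
  toFun ρ := VChar.twist (FinChar.infl ω hω χ⁻¹) (VChar.infl ρ)
  map_zero' := Subtype.ext (funext fun _ => mul_zero _)
  map_add' _ _ := Subtype.ext (funext fun _ => mul_add _ _ _)

theorem VChar.twistInfl_apply (χ : FinChar p Γ) (ρ : VChar p (𝒢 ⧸ 𝒵.toSubgroup)) (g : 𝒢) :
    (VChar.twistInfl ω hω χ ρ).1 g =
      (((χ.1 (ω g))⁻¹ : (Zbar p)ˣ) : PadicAlgCl p) * ρ.1 (g : 𝒢 ⧸ 𝒵.toSubgroup) := rfl

/-- After twisting by `χ ∘ ω` the subgroup `𝒵` acts trivially on `W`, so the action descends to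
`𝒢/𝒵`; the factor `χ⁻¹ ∘ ω` restores the original trace. -/
theorem exists_twistInfl_eq_trace_restrict {n : ℕ} {r : 𝒢 →* Matrix (Fin n) (Fin n) (PadicAlgCl p)}
    {W : Submodule (PadicAlgCl p) (Fin n → PadicAlgCl p)}
    (hW : ∀ g, Set.MapsTo (Matrix.toLin' (r g)) W W) (χ : FinChar p Γ)
    (hχ : ∀ z ∈ 𝒵.toSubgroup, ∀ w ∈ W,
      ((χ.1 (ω z) : Zbar p) : PadicAlgCl p) • Matrix.toLin' (r z) w = w) :
    ∃ ρ : VChar p (𝒢 ⧸ 𝒵.toSubgroup), ∀ g,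
      LinearMap.trace _ W ((Matrix.toLin' (r g)).restrict (hW g)) =
        (VChar.twistInfl ω hω χ ρ).1 g := by
  let v : (Zbar p)ˣ →* PadicAlgCl p :=
    ((integralClosure ℤ_[p] (PadicAlgCl p)).val : Zbar p →* PadicAlgCl p).comp (Units.coeHom _)
  let R : 𝒢 →* Module.End (PadicAlgCl p) W :=
    { toFun := fun g => v (χ.1 (ω g)) • (Matrix.toLin' (r g)).restrict (hW g)
      map_one' := by
        ext w : 2
        simp
      map_mul' := fun a b => by
        ext w : 2
        change v (χ.1 (ω (a * b))) • Matrix.toLin' (r (a * b)) (w : Fin n → PadicAlgCl p) =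
          v (χ.1 (ω a)) • Matrix.toLin' (r a) (v (χ.1 (ω b)) • Matrix.toLin' (r b) w)
        rw [map_smul, smul_smul, map_mul, map_mul, map_mul, map_mul, Matrix.toLin'_mul]
        rfl }
  have hR : ∀ z ∈ 𝒵.toSubgroup, R z = 1 := by
    intro z hz
    ext w : 2
    exact hχ z hz w w.2
  let b := Module.finBasis (PadicAlgCl p) W
  let s : 𝒢 ⧸ 𝒵.toSubgroup →* Matrix (Fin (finrank (PadicAlgCl p) W))
      (Fin (finrank (PadicAlgCl p) W)) (PadicAlgCl p) :=
    ((LinearMap.toMatrixAlgEquiv b : _ →* _)).comp (QuotientGroup.lift 𝒵.toSubgroup R hR)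
  have : DiscreteTopology (𝒢 ⧸ 𝒵.toSubgroup) := QuotientGroup.discreteTopology 𝒵.isOpen'
  refine ⟨⟨fun g => (s g).trace, AddSubgroup.subset_closure
    ⟨_, s, isOpen_discrete _, fun _ => rfl⟩⟩, fun g => ?_⟩
  rw [VChar.twistInfl_apply]
  have h1 : (s g).trace = v (χ.1 (ω g)) *
      LinearMap.trace _ W ((Matrix.toLin' (r g)).restrict (hW g)) := by
    rw [← smul_eq_mul, ← map_smul]
    exact (LinearMap.trace_eq_matrix_trace _ b _).symm
  have h2 : v (χ.1 (ω g))⁻¹ * v (χ.1 (ω g)) = 1 := by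
    rw [← map_mul, inv_mul_cancel, map_one]
  change _ = v (χ.1 (ω g))⁻¹ * (s g).trace
  rw [h1, ← mul_assoc, h2, one_mul]

end Generation

/-! ### Decomposition of representations under the central subgroup -/

section Decomposition

variable {p : ℕ} [Fact p.Prime]
variable {𝒢 : Type*} [Group 𝒢] [TopologicalSpace 𝒢] [IsTopologicalGroup 𝒢] [CompactSpace 𝒢]
variable {Γ : Type*} [CommGroup Γ] [TopologicalSpace Γ] [IsTopologicalGroup Γ] [CompactSpace Γ]
  [T2Space Γ] {𝒵 : OpenNormalSubgroup 𝒢} {ω : 𝒢 →* Γ} {hω : Continuous ω}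

/-- The operator is a root of `X^m - 1`, which is separable in characteristic zero. -/
theorem isSemisimple_of_pow_eq_one {K V : Type*} [Field K] [CharZero K] [AddCommGroup V]
    [Module K V] {f : Module.End K V} {m : ℕ} (hm : m ≠ 0) (hf : f ^ m = 1) : f.IsSemisimple := by
  refine Module.End.isSemisimple_of_squarefree_aeval_eq_zero (p := Polynomial.X ^ m - 1)
    (Polynomial.X_pow_sub_one_separable_iff.2 (Nat.cast_ne_zero.2 hm)).squarefree ?_
  simp [hf]

theorem isSemisimple_toLin'_of_isOpen_ker {n : ℕ}
    {r : 𝒢 →* Matrix (Fin n) (Fin n) (PadicAlgCl p)} (hr : IsOpen (r.ker : Set 𝒢)) (g : 𝒢) :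
    Module.End.IsSemisimple (Matrix.toLin' (r g)) := by
  have := Subgroup.quotient_finite_of_isOpen _ hr
  have : r.ker.FiniteIndex := Subgroup.finiteIndex_of_finite_quotient
  refine isSemisimple_of_pow_eq_one (m := r.ker.index) Subgroup.FiniteIndex.index_ne_zero ?_
  have h : r (g ^ r.ker.index) = 1 := Subgroup.pow_index_mem r.ker g
  rw [← Matrix.toLin'_pow, ← map_pow, h, Matrix.toLin'_one]
  rfl

/-- A nonzero joint eigenspace of the central subgroup is untwisted by a character of `Γ`. -/
theorem exists_finChar_untwisting (hω : Continuous ω) (hsurj : Function.Surjective ω)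
    (hinj : ∀ z ∈ 𝒵.toSubgroup, ω z = 1 → z = 1) {n : ℕ}
    {r : 𝒢 →* Matrix (Fin n) (Fin n) (PadicAlgCl p)} (hr : IsOpen (r.ker : Set 𝒢))
    {W : Submodule (PadicAlgCl p) (Fin n → PadicAlgCl p)} (hW : W ≠ ⊥)
    {c : 𝒵.toSubgroup → PadicAlgCl p}
    (hc : ∀ (z : 𝒵.toSubgroup), ∀ w ∈ W, Matrix.toLin' (r z) w = c z • w) :
    ∃ χ : FinChar p Γ, ∀ z ∈ 𝒵.toSubgroup, ∀ w ∈ W,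
      ((χ.1 (ω z) : Zbar p) : PadicAlgCl p) • Matrix.toLin' (r z) w = w := by
  obtain ⟨w, hw, hw0⟩ := Submodule.exists_mem_ne_zero_of_ne_bot hW
  have huniq : ∀ {a b : PadicAlgCl p}, a • w = b • w → a = b := fun h =>
    smul_left_injective _ hw0 h
  let ch : 𝒵.toSubgroup →* PadicAlgCl p :=
    { toFun := c
      map_one' := huniq (by rw [← hc 1 w hw]; simp)
      map_mul' := fun a b => huniq (by
        rw [← hc _ w hw, Subgroup.coe_mul, map_mul, Matrix.toLin'_mul, LinearMap.comp_apply,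
          hc b w hw, map_smul, hc a w hw, smul_smul, mul_comm]) }
  have hker : ∀ z : 𝒵.toSubgroup, r z = 1 → ch z = 1 := fun z hz => huniq (by
    rw [one_smul]
    change c z • w = w
    rw [← hc z w hw, hz, Matrix.toLin'_one]
    rfl)
  have := Subgroup.quotient_finite_of_isOpen _ hr
  have : r.ker.FiniteIndex := Subgroup.finiteIndex_of_finite_quotient
  have hint : ∀ z, IsIntegral ℤ_[p] (ch z) := fun z => by
    refine IsIntegral.of_pow (n := r.ker.index)
      (Nat.pos_of_ne_zero Subgroup.FiniteIndex.index_ne_zero) ?_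
    rw [← map_pow, hker (z ^ r.ker.index) (Subgroup.pow_index_mem r.ker (z : 𝒢))]
    exact isIntegral_one
  let ψ : 𝒵.toSubgroup →* (Zbar p)ˣ :=
    (ch.codRestrict (integralClosure ℤ_[p] (PadicAlgCl p)) hint).toHomUnits
  have hψ : ∀ z, ((ψ z : Zbar p) : PadicAlgCl p) = c z := fun _ => rfl
  have hψo : IsOpen ((ψ⁻¹).ker : Set 𝒵.toSubgroup) := by
    refine Subgroup.isOpen_mono (H₁ := r.ker.subgroupOf 𝒵.toSubgroup) (fun z hz => ?_)
      (hr.preimage continuous_subtype_val)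
    have h1 : ψ z = 1 := Units.ext (Subtype.ext (hker z hz))
    rw [MonoidHom.mem_ker, MonoidHom.inv_apply, h1, inv_one]
  -- The inverse of the eigenvalue character is extended, so that multiplication by `χ ∘ ω` cancels
  -- the action of `𝒵`.
  obtain ⟨χ, hχ⟩ := exists_finChar_extending hω hsurj hinj ψ⁻¹ hψo
  refine ⟨χ, fun z hz w hw => ?_⟩
  rw [hc ⟨z, hz⟩ w hw, ← hψ, smul_smul, hχ ⟨z, hz⟩, ← Subalgebra.coe_mul, ← Units.val_mul,
    MonoidHom.inv_apply, inv_mul_cancel]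
  exact one_smul _ _

/-- The operators of the central `𝒵` commute with the whole representation and have finite order.
The space is therefore the direct sum of `𝒢`-stable joint eigenspaces, indexed by their eigenvalue
functions `c`, and the trace is the sum of the traces on them. -/
theorem exists_sum_twistInfl_of_isCharacter (hω : Continuous ω) (hsurj : Function.Surjective ω)
    (hinj : ∀ z ∈ 𝒵.toSubgroup, ω z = 1 → z = 1) (hcentral : 𝒵.toSubgroup ≤ Subgroup.center 𝒢)
    {f : 𝒢 → PadicAlgCl p} (hf : IsCharacter p 𝒢 f) :
    ∃ (s : Finset (𝒵.toSubgroup → PadicAlgCl p)) (χ : (𝒵.toSubgroup → PadicAlgCl p) → FinChar p Γ)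
      (ρ : (𝒵.toSubgroup → PadicAlgCl p) → VChar p (𝒢 ⧸ 𝒵.toSubgroup)),
      f = (∑ c ∈ s, VChar.twistInfl ω hω (χ c) (ρ c) : VChar p 𝒢).1 := by
  classical
  obtain ⟨n, r, hr, hfr⟩ := hf
  let T : 𝒵.toSubgroup → Module.End (PadicAlgCl p) (Fin n → PadicAlgCl p) :=
    fun z => Matrix.toLin' (r z)
  let W : (𝒵.toSubgroup → PadicAlgCl p) → Submodule (PadicAlgCl p) (Fin n → PadicAlgCl p) :=
    fun c => ⨅ z, (T z).maxGenEigenspace (c z)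
  have hcomm : ∀ (z : 𝒵.toSubgroup) (g : 𝒢), Commute (T z) (Matrix.toLin' (r g)) := by
    intro z g
    have h1 : (z : 𝒢) * g = g * z := ((Subgroup.mem_center_iff.1 (hcentral z.2)) g).symm
    change Matrix.toLin' (r z) ∘ₗ Matrix.toLin' (r g) = Matrix.toLin' (r g) ∘ₗ Matrix.toLin' (r z)
    rw [← Matrix.toLin'_mul, ← Matrix.toLin'_mul, ← map_mul, ← map_mul, h1]
  have hmaps : ∀ c g, Set.MapsTo (Matrix.toLin' (r g)) (W c) (W c) := by
    intro c g w hw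
    rw [SetLike.mem_coe, Submodule.mem_iInf] at hw ⊢
    exact fun z => Module.End.mapsTo_maxGenEigenspace_of_comm (hcomm z g) _ (hw z)
  have hind : iSupIndep W :=
    Module.End.independent_iInf_maxGenEigenspace_of_forall_mapsTo T fun i j _ =>
      Module.End.mapsTo_maxGenEigenspace_of_comm (hcomm j i) _
  have htop : ⨆ c, W c = ⊤ :=
    Module.End.iSup_iInf_maxGenEigenspace_eq_top_of_iSup_maxGenEigenspace_eq_top_of_commute T
      (fun i j _ => hcomm i j) fun z => Module.End.iSup_maxGenEigenspace_eq_top _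
  have hint := DirectSum.isInternal_submodule_of_iSupIndep_of_iSup_eq_top hind htop
  have hfin : {c | W c ≠ ⊥}.Finite := WellFoundedGT.finite_ne_bot_of_iSupIndep hind
  have key : ∀ c, ∃ (χ : FinChar p Γ) (ρ : VChar p (𝒢 ⧸ 𝒵.toSubgroup)), W c ≠ ⊥ → ∀ g,
      LinearMap.trace _ (W c) ((Matrix.toLin' (r g)).restrict (hmaps c g)) =
        (VChar.twistInfl ω hω χ ρ).1 g := by
    intro c
    by_cases hc : W c = ⊥
    · exact ⟨1, 0, fun h => absurd hc h⟩
    · obtain ⟨χ, hχ⟩ := exists_finChar_untwisting (p := p) (W := W c) (c := c) hω hsurj hinj hr hc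
        fun z w hw => by
          have h1 := (Submodule.mem_iInf _).1 hw z
          -- By semisimplicity the generalized eigenspaces in `W c` are eigenspaces, so `𝒵` acts on
          -- `W c` by scalars.
          rw [Module.End.IsFinitelySemisimple.maxGenEigenspace_eq_eigenspace
            (isSemisimple_toLin'_of_isOpen_ker hr z).isFinitelySemisimple] at h1
          exact Module.End.mem_eigenspace_iff.1 h1
      obtain ⟨ρ, hρ⟩ := exists_twistInfl_eq_trace_restrict (hω := hω) (hmaps c) χ hχ
      exact ⟨χ, ρ, fun _ => hρ⟩
  choose χ ρ hχρ using key
  refine ⟨hfin.toFinset, χ, ρ, ?_⟩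
  funext g
  rw [hfr, ← Matrix.trace_toLin'_eq,
    LinearMap.trace_eq_sum_trace_restrict' hint hfin (fun c => hmaps c g), AddSubgroup.val_finsetSum,
    Finset.sum_apply]
  exact Finset.sum_congr rfl fun c hc => hχρ c (hfin.mem_toFinset.1 hc) g

theorem iSup_range_twistInfl_eq_top (hω : Continuous ω) (hsurj : Function.Surjective ω)
    (hinj : ∀ z ∈ 𝒵.toSubgroup, ω z = 1 → z = 1) (hcentral : 𝒵.toSubgroup ≤ Subgroup.center 𝒢) :
    (⨆ χ : FinChar p Γ, (VChar.twistInfl (𝒵 := 𝒵) ω hω χ).range) = ⊤ := by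
  rw [eq_top_iff]
  intro ρ _
  have key := VChar.induction (p := p) (G := 𝒢) (motive := fun f => ∃ h : f ∈ VChar p 𝒢,
    (⟨f, h⟩ : VChar p 𝒢) ∈ ⨆ χ : FinChar p Γ, (VChar.twistInfl (𝒵 := 𝒵) ω hω χ).range) ?_
    ⟨_, AddSubgroup.zero_mem _⟩
    (fun f g ⟨h1, h2⟩ ⟨h3, h4⟩ => ⟨(VChar p 𝒢).add_mem h1 h3, AddSubgroup.add_mem _ h2 h4⟩)
    (fun f ⟨h1, h2⟩ => ⟨(VChar p 𝒢).neg_mem h1, AddSubgroup.neg_mem _ h2⟩) ρ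
  · exact key.2
  · intro f hf
    obtain ⟨s, χ, ρ, rfl⟩ := exists_sum_twistInfl_of_isCharacter hω hsurj hinj hcentral hf
    refine ⟨Subtype.property _, AddSubgroup.sum_mem _ fun c _ => ?_⟩
    exact (le_iSup (fun χ : FinChar p Γ => (VChar.twistInfl (𝒵 := 𝒵) ω hω χ).range) (χ c))
      ⟨ρ c, rfl⟩

end Decomposition

/-! ### `R(𝒢)` as a direct sum of copies of `R(𝒢/𝒵)` -/

section Assembly

variable {p : ℕ} [Fact p.Prime]
variable {𝒢 : Type*} [Group 𝒢] [TopologicalSpace 𝒢] [IsTopologicalGroup 𝒢]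
variable {Γ : Type*} [CommGroup Γ] [TopologicalSpace Γ] [IsTopologicalGroup Γ]
  {𝒵 : OpenNormalSubgroup 𝒢} {ω : 𝒢 →* Γ} {hω : Continuous ω}

variable (p 𝒵 ω) in
/-- The characters of `Γ` that are trivial on the image of the central subgroup. -/
def trivialOn : Subgroup (FinChar p Γ) where
  carrier := {η | ∀ z ∈ 𝒵.toSubgroup, η.1 (ω z) = 1}
  mul_mem' := fun {a b} ha hb z hz => by
    change a.1 (ω z) * b.1 (ω z) = 1
    rw [ha z hz, hb z hz, one_mul]
  one_mem' := fun _ _ => rfl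
  inv_mem' := fun {a} ha z hz => by
    change (a.1 (ω z))⁻¹ = 1
    rw [ha z hz, inv_one]

/-- The character of `𝒢/𝒵` induced by a character of `Γ` that is trivial on the image of `𝒵`. -/
def descend (η : FinChar p Γ) (hη : η ∈ trivialOn p 𝒵 ω) : FinChar p (𝒢 ⧸ 𝒵.toSubgroup) :=
  ⟨QuotientGroup.lift 𝒵.toSubgroup (η.1.comp ω) hη, by
    have : DiscreteTopology (𝒢 ⧸ 𝒵.toSubgroup) := QuotientGroup.discreteTopology 𝒵.isOpen'
    exact isOpen_discrete (α := 𝒢 ⧸ 𝒵.toSubgroup) _⟩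

/-- A change of `χ` by a character trivial on `ω(𝒵)` can be absorbed in `ρ`. Hence one
representative `χ` per class suffices, and the formula for `BrInd` has to respect this change. -/
theorem twistInfl_twist_descend (χ η : FinChar p Γ) (hη : η ∈ trivialOn p 𝒵 ω)
    (ρ : VChar p (𝒢 ⧸ 𝒵.toSubgroup)) :
    VChar.twistInfl ω hω (η * χ) (VChar.twist (descend η hη) ρ) = VChar.twistInfl ω hω χ ρ := by
  apply Subtype.ext
  funext g
  rw [VChar.twistInfl_apply, VChar.twistInfl_apply]
  change ((((η.1 (ω g) * χ.1 (ω g))⁻¹ : (Zbar p)ˣ) : Zbar p) : PadicAlgCl p) *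
    (((η.1 (ω g) : Zbar p) : PadicAlgCl p) * _) = _
  rw [← mul_assoc, ← Subalgebra.coe_mul, ← Units.val_mul, mul_inv_rev, inv_mul_cancel_right]

variable (p 𝒵 ω hω) in
/-- The sum of twisted inflations over representatives of the classes of characters of `Γ` with
the same restriction to the image of `𝒵`. -/
def sumTwistInfl :
    ((FinChar p Γ ⧸ trivialOn p 𝒵 ω) →₀ VChar p (𝒢 ⧸ 𝒵.toSubgroup)) →+ VChar p 𝒢 :=
  Finsupp.liftAddHom fun q => VChar.twistInfl ω hω q.out

theorem twistInfl_eq_sumTwistInfl (χ : FinChar p Γ) (ρ : VChar p (𝒢 ⧸ 𝒵.toSubgroup)) :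
    ∃ hη : (QuotientGroup.mk χ : FinChar p Γ ⧸ trivialOn p 𝒵 ω).out * χ⁻¹ ∈ trivialOn p 𝒵 ω,
      VChar.twistInfl ω hω χ ρ = sumTwistInfl p 𝒵 ω hω
        (Finsupp.single (QuotientGroup.mk χ) (VChar.twist (descend _ hη) ρ)) := by
  have hη : (QuotientGroup.mk χ : FinChar p Γ ⧸ trivialOn p 𝒵 ω).out * χ⁻¹ ∈ trivialOn p 𝒵 ω := by
    rw [mul_comm]
    exact QuotientGroup.eq.1 (QuotientGroup.out_eq' _).symm
  refine ⟨hη, ?_⟩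
  rw [sumTwistInfl, Finsupp.liftAddHom_apply_single, ← twistInfl_twist_descend χ _ hη ρ,
    inv_mul_cancel_right]

/-- Distinct classes restrict to distinct characters of `𝒵`. At `gz` with `z ∈ 𝒵`, a vanishing sum
is a linear relation between these characters whose coefficients are the terms at `g`, and linear
independence kills each term. -/
theorem sumTwistInfl_injective : Function.Injective (sumTwistInfl p 𝒵 ω hω) := by
  rw [injective_iff_map_eq_zero]
  intro v hv
  let K := PadicAlgCl p
  let θ : (FinChar p Γ ⧸ trivialOn p 𝒵 ω) → (𝒵.toSubgroup →* K) := fun q =>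
    ((integralClosure ℤ_[p] (PadicAlgCl p)).val : Zbar p →* PadicAlgCl p).comp
      ((Units.coeHom _).comp (((q.out⁻¹ : FinChar p Γ).1.comp ω).comp 𝒵.toSubgroup.subtype))
  have hθ : Function.Injective θ := by
    intro q q' h
    rw [← QuotientGroup.out_eq' q, ← QuotientGroup.out_eq' q', QuotientGroup.eq]
    intro z hz
    have h1 := DFunLike.congr_fun h ⟨z, hz⟩
    have h2 : (q.out.1 (ω z))⁻¹ = (q'.out.1 (ω z))⁻¹ := Units.ext (Subtype.ext h1)
    change (q.out.1 (ω z))⁻¹ * q'.out.1 (ω z) = 1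
    rw [h2, inv_mul_cancel]
  have hli := (linearIndependent_monoidHom 𝒵.toSubgroup K).comp θ hθ
  have hval : ∀ (w : (FinChar p Γ ⧸ trivialOn p 𝒵 ω) →₀ VChar p (𝒢 ⧸ 𝒵.toSubgroup)) (g : 𝒢),
      (sumTwistInfl p 𝒵 ω hω w).1 g = ∑ q ∈ w.support, (VChar.twistInfl ω hω q.out (w q)).1 g := by
    intro w g
    rw [sumTwistInfl, Finsupp.liftAddHom_apply, Finsupp.sum, AddSubgroup.val_finsetSum,
      Finset.sum_apply]
  ext1 q
  apply Subtype.ext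
  funext y
  obtain ⟨g, rfl⟩ := QuotientGroup.mk_surjective y
  by_cases hq : q ∈ v.support
  swap
  · rw [Finsupp.notMem_support_iff.1 hq]
    rfl
  have h1 := linearIndependent_iff'.1 hli v.support
    (fun q => (VChar.twistInfl ω hω q.out (v q)).1 g) (by
      funext z
      have h2 := hval v (g * z)
      rw [hv] at h2
      rw [Finset.sum_apply]
      refine Eq.trans (Finset.sum_congr rfl fun q _ => ?_) h2.symm
      have h3 : ((g * z : 𝒢) : 𝒢 ⧸ 𝒵.toSubgroup) = g := by
        rw [QuotientGroup.mk_mul_of_mem _ z.2]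
      rw [VChar.twistInfl_apply, VChar.twistInfl_apply, h3]
      change _ * _ * (((((q.out : FinChar p Γ).1 (ω z))⁻¹ : (Zbar p)ˣ) : Zbar p) :
        PadicAlgCl p) = _
      rw [map_mul, map_mul, mul_inv, Units.val_mul, Subalgebra.coe_mul]
      ring) q hq
  rw [VChar.twistInfl_apply] at h1
  refine (mul_eq_zero.1 h1).resolve_left fun h => ?_
  exact Units.ne_zero _ (Subtype.ext h)

theorem VChar.gal_twistInfl (σ : PadicAlgCl p ≃ₐ[ℚ_[p]] PadicAlgCl p) (χ : FinChar p Γ)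
    (ρ : VChar p (𝒢 ⧸ 𝒵.toSubgroup)) :
    VChar.gal σ (VChar.twistInfl ω hω χ ρ) =
      VChar.twistInfl ω hω (FinChar.gal σ χ) (VChar.gal σ ρ) :=
  Subtype.ext (funext fun _ => map_mul σ _ _)

theorem VChar.twist_twistInfl (φ χ : FinChar p Γ) (ρ : VChar p (𝒢 ⧸ 𝒵.toSubgroup)) :
    VChar.twist (FinChar.infl ω hω φ) (VChar.twistInfl ω hω χ ρ) =
      VChar.twistInfl ω hω (φ⁻¹ * χ) ρ := by
  apply Subtype.ext
  funext g
  rw [VChar.twistInfl_apply]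
  change ((φ.1 (ω g) : Zbar p) : PadicAlgCl p) *
    ((((χ.1 (ω g))⁻¹ : (Zbar p)ˣ) : PadicAlgCl p) * _) =
    (((((φ.1 (ω g))⁻¹ * χ.1 (ω g))⁻¹ : (Zbar p)ˣ) : Zbar p) : PadicAlgCl p) * _
  rw [← mul_assoc, ← Subalgebra.coe_mul, ← Units.val_mul, mul_inv_rev, inv_inv,
    mul_comm (φ.1 (ω g))]
  rfl

/-- Together with `twist_twistInfl_apply` this rewrites the condition that `(χ ∘ ω)ρ` is inflated
from `ρ'` as an explicit formula for `ρ`. -/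
theorem eq_twistInfl {ρ : VChar p 𝒢} {χ : FinChar p Γ} {ρ' : VChar p (𝒢 ⧸ 𝒵.toSubgroup)}
    (h : ∀ g : 𝒢, (VChar.twist (FinChar.infl ω hω χ) ρ).1 g = ρ'.1 (g : 𝒢 ⧸ 𝒵.toSubgroup)) :
    ρ = VChar.twistInfl ω hω χ ρ' := by
  apply Subtype.ext
  funext g
  rw [VChar.twistInfl_apply, ← h g]
  change _ = _ * (((χ.1 (ω g) : Zbar p) : PadicAlgCl p) * ρ.1 g)
  rw [← mul_assoc, ← Subalgebra.coe_mul, ← Units.val_mul, inv_mul_cancel]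
  exact (one_mul _).symm

theorem twist_twistInfl_apply (χ : FinChar p Γ) (ρ : VChar p (𝒢 ⧸ 𝒵.toSubgroup)) (g : 𝒢) :
    (VChar.twist (FinChar.infl ω hω χ) (VChar.twistInfl ω hω χ ρ)).1 g =
      ρ.1 (g : 𝒢 ⧸ 𝒵.toSubgroup) := by
  rw [VChar.twist_twistInfl, inv_mul_cancel, VChar.twistInfl_apply]
  change ((((1 : (Zbar p)ˣ)⁻¹ : (Zbar p)ˣ) : Zbar p) : PadicAlgCl p) * _ = _
  rw [inv_one]
  exact one_mul _

end Assembly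

/-! ### Extension to `R(𝒢)`, equivariance and multiplicativity -/

section BrInd

variable {p : ℕ} [Fact p.Prime]
variable {𝒢 : Type*} [Group 𝒢] [TopologicalSpace 𝒢] [IsTopologicalGroup 𝒢] [CompactSpace 𝒢]
variable {Γ : Type*} [CommGroup Γ] [TopologicalSpace Γ] [IsTopologicalGroup Γ] [CompactSpace Γ]
  [T2Space Γ] {𝒵 : OpenNormalSubgroup 𝒢} {ω : 𝒢 →* Γ} {hω : Continuous ω}

theorem sumTwistInfl_surjective (hsurj : Function.Surjective ω)
    (hinj : ∀ z ∈ 𝒵.toSubgroup, ω z = 1 → z = 1) (hcentral : 𝒵.toSubgroup ≤ Subgroup.center 𝒢) :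
    Function.Surjective (sumTwistInfl p 𝒵 ω hω) := by
  rw [← AddMonoidHom.range_eq_top, eq_top_iff,
    ← iSup_range_twistInfl_eq_top (p := p) hω hsurj hinj hcentral, iSup_le_iff]
  rintro χ _ ⟨ρ, rfl⟩
  obtain ⟨hη, h⟩ := twistInfl_eq_sumTwistInfl (hω := hω) χ ρ
  exact ⟨_, h.symm⟩

theorem VChar.induction_twistInfl (hsurj : Function.Surjective ω)
    (hinj : ∀ z ∈ 𝒵.toSubgroup, ω z = 1 → z = 1) (hcentral : 𝒵.toSubgroup ≤ Subgroup.center 𝒢)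
    {motive : VChar p 𝒢 → Prop}
    (twist : ∀ (χ : FinChar p Γ) (ρ : VChar p (𝒢 ⧸ 𝒵.toSubgroup)),
      motive (VChar.twistInfl ω hω χ ρ))
    (add : ∀ ρ ρ', motive ρ → motive ρ' → motive (ρ + ρ')) (ρ : VChar p 𝒢) : motive ρ := by
  obtain ⟨v, rfl⟩ := sumTwistInfl_surjective (p := p) (hω := hω) hsurj hinj hcentral ρ
  induction v using Finsupp.induction_linear with
  | zero => simpa using twist 1 0
  | add f g hf hg => rw [map_add]; exact add _ _ hf hg
  | single q ρ => rw [sumTwistInfl, Finsupp.liftAddHom_apply_single]; exact twist _ _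

/-- Virtual characters of `𝒢` as sums of twisted inflations. -/
def sumTwistInflEquiv (hω : Continuous ω) (hsurj : Function.Surjective ω)
    (hinj : ∀ z ∈ 𝒵.toSubgroup, ω z = 1 → z = 1) (hcentral : 𝒵.toSubgroup ≤ Subgroup.center 𝒢) :
    ((FinChar p Γ ⧸ trivialOn p 𝒵 ω) →₀ VChar p (𝒢 ⧸ 𝒵.toSubgroup)) ≃+ VChar p 𝒢 :=
  AddEquiv.ofBijective (sumTwistInfl p 𝒵 ω hω) ⟨sumTwistInfl_injective,
    sumTwistInfl_surjective (hω := hω) hsurj hinj hcentral⟩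

/-- The homomorphism on the virtual characters of `𝒢` that is given on twisted inflations. -/
def extendTwistInfl {M : Type*} [AddCommMonoid M] (hω : Continuous ω)
    (hsurj : Function.Surjective ω) (hinj : ∀ z ∈ 𝒵.toSubgroup, ω z = 1 → z = 1)
    (hcentral : 𝒵.toSubgroup ≤ Subgroup.center 𝒢)
    (F : FinChar p Γ → VChar p (𝒢 ⧸ 𝒵.toSubgroup) →+ M) : VChar p 𝒢 →+ M :=
  (Finsupp.liftAddHom fun q : FinChar p Γ ⧸ trivialOn p 𝒵 ω => F q.out).comp
    (sumTwistInflEquiv hω hsurj hinj hcentral).symm.toAddMonoidHom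

/-- The extension is built from `F` at the chosen representatives only; `hF` moves an arbitrary `χ`
to the representative of its class. -/
theorem extendTwistInfl_twistInfl {M : Type*} [AddCommMonoid M] (hω : Continuous ω)
    (hsurj : Function.Surjective ω) (hinj : ∀ z ∈ 𝒵.toSubgroup, ω z = 1 → z = 1)
    (hcentral : 𝒵.toSubgroup ≤ Subgroup.center 𝒢)
    (F : FinChar p Γ → VChar p (𝒢 ⧸ 𝒵.toSubgroup) →+ M)
    (hF : ∀ (χ η : FinChar p Γ) (hη : η ∈ trivialOn p 𝒵 ω) (ρ : VChar p (𝒢 ⧸ 𝒵.toSubgroup)),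
      F (η * χ) (VChar.twist (descend η hη) ρ) = F χ ρ)
    (χ : FinChar p Γ) (ρ : VChar p (𝒢 ⧸ 𝒵.toSubgroup)) :
    extendTwistInfl hω hsurj hinj hcentral F (VChar.twistInfl ω hω χ ρ) = F χ ρ := by
  obtain ⟨hη, h⟩ := twistInfl_eq_sumTwistInfl (hω := hω) χ ρ
  have h1 : (sumTwistInflEquiv hω hsurj hinj hcentral).symm (VChar.twistInfl ω hω χ ρ) =
      Finsupp.single (QuotientGroup.mk χ) (VChar.twist (descend _ hη) ρ) :=
    (AddEquiv.symm_apply_eq _).2 h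
  refine (congrArg _ h1).trans ((Finsupp.liftAddHom_apply_single _ _ _).trans ?_)
  rw [← hF χ _ hη, inv_mul_cancel_right]

/-- A homomorphism on the virtual characters of `𝒢/𝒵` that is equivariant for twists by characters
of `Γ` extends to the virtual characters of `𝒢`. -/
theorem exists_extend_twistInfl {M : Type*} [CommGroup M]
    (hω : Continuous ω) (hsurj : Function.Surjective ω)
    (hinj : ∀ z ∈ 𝒵.toSubgroup, ω z = 1 → z = 1) (hcentral : 𝒵.toSubgroup ≤ Subgroup.center 𝒢)
    (tw : FinChar p Γ → M →* M) (htw : ∀ φ ψ m, tw φ (tw ψ m) = tw (φ * ψ) m)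
    (b : VChar p (𝒢 ⧸ 𝒵.toSubgroup) → M)
    (hb : ∀ ρ ρ', b (ρ + ρ') = b ρ * b ρ')
    (hbtw : ∀ (η : FinChar p Γ) (hη : η ∈ trivialOn p 𝒵 ω) (ρ : VChar p (𝒢 ⧸ 𝒵.toSubgroup)),
      b (VChar.twist (descend η hη) ρ) = tw η (b ρ)) :
    ∃ f : Multiplicative (VChar p 𝒢) →* M, ∀ (χ : FinChar p Γ)
      (ρ : VChar p (𝒢 ⧸ 𝒵.toSubgroup)),
      f (Multiplicative.ofAdd (VChar.twistInfl ω hω χ ρ)) = tw χ⁻¹ (b ρ) := by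
  let F : FinChar p Γ → VChar p (𝒢 ⧸ 𝒵.toSubgroup) →+ Additive M := fun χ =>
    AddMonoidHom.mk' (fun ρ => Additive.ofMul (tw χ⁻¹ (b ρ))) fun ρ ρ' => by
      rw [hb, map_mul, ofMul_mul]
  refine ⟨AddMonoidHom.toMultiplicativeLeft (extendTwistInfl hω hsurj hinj hcentral F),
    fun χ ρ => congrArg Additive.toMul (extendTwistInfl_twistInfl hω hsurj hinj hcentral F
      (fun χ η hη ρ => ?_) χ ρ)⟩
  -- The twist by `η` coming from the equivariance of `b` cancels against the `η⁻¹` in `(ηχ)⁻¹`.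
  change Additive.ofMul (tw (η * χ)⁻¹ (b (VChar.twist (descend η hη) ρ))) =
    Additive.ofMul (tw χ⁻¹ (b ρ))
  rw [hbtw, htw, mul_inv_rev, inv_mul_cancel_right]

theorem monoidHom_eq_of_twistInfl {M : Type*} [CommGroup M] (hω : Continuous ω)
    (hsurj : Function.Surjective ω)
    (hinj : ∀ z ∈ 𝒵.toSubgroup, ω z = 1 → z = 1) (hcentral : 𝒵.toSubgroup ≤ Subgroup.center 𝒢)
    {f g : Multiplicative (VChar p 𝒢) →* M}
    (h : ∀ (χ : FinChar p Γ) (ρ : VChar p (𝒢 ⧸ 𝒵.toSubgroup)),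
      f (Multiplicative.ofAdd (VChar.twistInfl ω hω χ ρ)) =
        g (Multiplicative.ofAdd (VChar.twistInfl ω hω χ ρ))) : f = g := by
  ext ρ
  refine VChar.induction_twistInfl (hω := hω) (motive := fun ρ =>
    f (Multiplicative.ofAdd ρ) = g (Multiplicative.ofAdd ρ)) hsurj hinj hcentral h
    (fun ρ ρ' h1 h2 => ?_) (Multiplicative.toAdd ρ)
  rw [ofAdd_add, map_mul, map_mul, h1, h2]

variable (p 𝒢) in
/-- The action of `σ` on virtual characters as a homomorphism. -/
def VChar.galHom (σ : PadicAlgCl p ≃ₐ[ℚ_[p]] PadicAlgCl p) : VChar p 𝒢 →+ VChar p 𝒢 :=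
  AddMonoidHom.mk' (VChar.gal σ) fun _ _ => Subtype.ext (funext fun _ => map_add σ _ _)

/-- The multiplication by a character of dimension one as a homomorphism. -/
def VChar.twistHom (χ : FinChar p 𝒢) : VChar p 𝒢 →+ VChar p 𝒢 :=
  AddMonoidHom.mk' (VChar.twist χ) fun _ _ => Subtype.ext (funext fun _ => mul_add _ _ _)

/-- Both sides are homomorphisms in `ρ`, so they need comparison only on twisted inflations, where
`σ` acts on the twist and on `ρ` separately. -/
theorem apply_gal_of_apply_twistInfl {M : Type*} [CommGroup M]
    (hω : Continuous ω) (hsurj : Function.Surjective ω)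
    (hinj : ∀ z ∈ 𝒵.toSubgroup, ω z = 1 → z = 1) (hcentral : 𝒵.toSubgroup ≤ Subgroup.center 𝒢)
    (tw : FinChar p Γ → M →* M) (b : VChar p (𝒢 ⧸ 𝒵.toSubgroup) → M)
    {f : Multiplicative (VChar p 𝒢) →* M} (hf : ∀ (χ : FinChar p Γ)
      (ρ : VChar p (𝒢 ⧸ 𝒵.toSubgroup)),
      f (Multiplicative.ofAdd (VChar.twistInfl ω hω χ ρ)) = tw χ⁻¹ (b ρ))
    (σ : PadicAlgCl p ≃ₐ[ℚ_[p]] PadicAlgCl p) (s : M →* M) (hb : ∀ ρ, b (VChar.gal σ ρ) = s (b ρ))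
    (hs : ∀ φ m, s (tw φ m) = tw (FinChar.gal σ φ) (s m)) (ρ : VChar p 𝒢) :
    f (Multiplicative.ofAdd (VChar.gal σ ρ)) = s (f (Multiplicative.ofAdd ρ)) := by
  refine DFunLike.congr_fun (monoidHom_eq_of_twistInfl hω hsurj hinj hcentral
    (f := f.comp (AddMonoidHom.toMultiplicative (VChar.galHom p 𝒢 σ))) (g := s.comp f)
    fun χ ρ => ?_) (Multiplicative.ofAdd ρ)
  refine (congrArg (fun ρ => f (Multiplicative.ofAdd ρ)) (VChar.gal_twistInfl σ χ ρ)).trans ?_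
  rw [MonoidHom.comp_apply, hf, hf, hb, hs]
  rfl

theorem apply_twist_of_apply_twistInfl {M : Type*} [CommGroup M]
    (hω : Continuous ω) (hsurj : Function.Surjective ω)
    (hinj : ∀ z ∈ 𝒵.toSubgroup, ω z = 1 → z = 1) (hcentral : 𝒵.toSubgroup ≤ Subgroup.center 𝒢)
    (tw : FinChar p Γ → M →* M) (htw : ∀ φ ψ m, tw φ (tw ψ m) = tw (φ * ψ) m)
    (b : VChar p (𝒢 ⧸ 𝒵.toSubgroup) → M)
    {f : Multiplicative (VChar p 𝒢) →* M} (hf : ∀ (χ : FinChar p Γ)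
      (ρ : VChar p (𝒢 ⧸ 𝒵.toSubgroup)),
      f (Multiplicative.ofAdd (VChar.twistInfl ω hω χ ρ)) = tw χ⁻¹ (b ρ))
    (φ : FinChar p Γ) (ρ : VChar p 𝒢) :
    f (Multiplicative.ofAdd (VChar.twist (FinChar.infl ω hω φ) ρ)) =
      tw φ (f (Multiplicative.ofAdd ρ)) := by
  refine DFunLike.congr_fun (monoidHom_eq_of_twistInfl hω hsurj hinj hcentral
    (f := f.comp (AddMonoidHom.toMultiplicative (VChar.twistHom (FinChar.infl ω hω φ))))
    (g := (tw φ).comp f) fun χ ρ => ?_) (Multiplicative.ofAdd ρ)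
  refine (congrArg (fun ρ => f (Multiplicative.ofAdd ρ)) (VChar.twist_twistInfl φ χ ρ)).trans ?_
  rw [MonoidHom.comp_apply, hf, hf, htw, mul_inv_rev, inv_inv, mul_comm χ⁻¹]

/-- The twist by `φ` on the unit group. -/
def TwUnits (φ : FinChar p Γ) : (LambdaZbar p Γ)ˣ →* (LambdaZbar p Γ)ˣ :=
  Units.map (Tw φ).toMonoidHom

theorem TwUnits_TwUnits (φ ψ : FinChar p Γ) (u : (LambdaZbar p Γ)ˣ) :
    TwUnits φ (TwUnits ψ u) = TwUnits (φ * ψ) u :=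
  Units.ext (Tw_Tw φ ψ u.val)

theorem brValue_twist_descend (x : InvTuples p 𝒵) (η : FinChar p Γ) (hη : η ∈ trivialOn p 𝒵 ω)
    (ρ : VChar p (𝒢 ⧸ 𝒵.toSubgroup)) :
      brValue ω hω x (VChar.twist (descend η hη) ρ) = TwUnits η (brValue ω hω x ρ) :=
  brValue_twist x (descend η hη) η (fun _ => rfl) ρ
theorem exists_monoidHom_twistInfl (hω : Continuous ω) (hsurj : Function.Surjective ω)
    (hinj : ∀ z ∈ 𝒵.toSubgroup, ω z = 1 → z = 1) (hcentral : 𝒵.toSubgroup ≤ Subgroup.center 𝒢)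
    (x : InvTuples p 𝒵) :
    ∃ f : Multiplicative (VChar p 𝒢) →* (LambdaZbar p Γ)ˣ,
      ∀ (χ : FinChar p Γ) (ρ : VChar p (𝒢 ⧸ 𝒵.toSubgroup)),
      f (Multiplicative.ofAdd (VChar.twistInfl ω hω χ ρ)) =
        TwUnits χ⁻¹ (brValue ω hω x ρ) := by
  refine exists_extend_twistInfl (p := p) (M := (LambdaZbar p Γ)ˣ) hω hsurj hinj hcentral
    (TwUnits (p := p) (Γ := Γ)) ?_ (brValue ω hω x) ?_ ?_
  · exact TwUnits_TwUnits
  · exact (brValue_add x)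
  · exact brValue_twist_descend x

theorem exists_brInd (hω : Continuous ω) (hsurj : Function.Surjective ω)
    (hinj : ∀ z ∈ 𝒵.toSubgroup, ω z = 1 → z = 1) (hcentral : 𝒵.toSubgroup ≤ Subgroup.center 𝒢)
    (x : InvTuples p 𝒵) :
    ∃ f : HomDescription p ω hω, ∀ (χ : FinChar p Γ) (ρ : VChar p (𝒢 ⧸ 𝒵.toSubgroup)),
      f.1 (Multiplicative.ofAdd (VChar.twistInfl ω hω χ ρ)) =
        TwUnits χ⁻¹ (brValue ω hω x ρ) := by
  obtain ⟨f, hf⟩ := exists_monoidHom_twistInfl hω hsurj hinj hcentral x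
  refine ⟨⟨f, fun σ => ?_, ?_⟩, hf⟩
  · refine apply_gal_of_apply_twistInfl (p := p) (M := (LambdaZbar p Γ)ˣ) hω hsurj hinj hcentral
      (TwUnits (p := p) (Γ := Γ))
      (brValue ω hω x) hf σ (Units.map (galLambda σ).toMonoidHom) ?_ ?_
    · exact (brValue_gal x σ)
    · exact (fun φ u => Units.ext (galLambda_Tw σ φ u.val))
  · refine apply_twist_of_apply_twistInfl (p := p) (M := (LambdaZbar p Γ)ˣ) hω hsurj hinj hcentral
      (TwUnits (p := p) (Γ := Γ)) ?_
      (brValue ω hω x) hf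
    exact TwUnits_TwUnits

theorem HomDescription.eq_of_twistInfl (hω : Continuous ω) (hsurj : Function.Surjective ω)
    (hinj : ∀ z ∈ 𝒵.toSubgroup, ω z = 1 → z = 1) (hcentral : 𝒵.toSubgroup ≤ Subgroup.center 𝒢)
    (f g : HomDescription p ω hω)
    (v : FinChar p Γ → VChar p (𝒢 ⧸ 𝒵.toSubgroup) → (LambdaZbar p Γ)ˣ)
    (hf : ∀ (χ : FinChar p Γ) (ρ : VChar p (𝒢 ⧸ 𝒵.toSubgroup)),
      f.1 (Multiplicative.ofAdd (VChar.twistInfl ω hω χ ρ)) = v χ ρ)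
    (hg : ∀ (χ : FinChar p Γ) (ρ : VChar p (𝒢 ⧸ 𝒵.toSubgroup)),
      g.1 (Multiplicative.ofAdd (VChar.twistInfl ω hω χ ρ)) = v χ ρ) : f = g :=
  Subtype.ext (monoidHom_eq_of_twistInfl (p := p) (M := (LambdaZbar p Γ)ˣ)
    hω hsurj hinj hcentral fun χ ρ => (hf χ ρ).trans (hg χ ρ).symm)

theorem monoidHom_brInd_mul (hω : Continuous ω) (hsurj : Function.Surjective ω)
    (hinj : ∀ z ∈ 𝒵.toSubgroup, ω z = 1 → z = 1) (hcentral : 𝒵.toSubgroup ≤ Subgroup.center 𝒢)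
    (x y : InvTuples p 𝒵) (f g h : HomDescription p ω hω)
    (hf : ∀ (χ : FinChar p Γ) (ρ : VChar p (𝒢 ⧸ 𝒵.toSubgroup)),
      f.1 (Multiplicative.ofAdd (VChar.twistInfl ω hω χ ρ)) = TwUnits χ⁻¹ (brValue ω hω x ρ))
    (hg : ∀ (χ : FinChar p Γ) (ρ : VChar p (𝒢 ⧸ 𝒵.toSubgroup)),
      g.1 (Multiplicative.ofAdd (VChar.twistInfl ω hω χ ρ)) = TwUnits χ⁻¹ (brValue ω hω y ρ))
    (hh : ∀ (χ : FinChar p Γ) (ρ : VChar p (𝒢 ⧸ 𝒵.toSubgroup)),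
      h.1 (Multiplicative.ofAdd (VChar.twistInfl ω hω χ ρ)) =
        TwUnits χ⁻¹ (brValue ω hω (x * y) ρ)) : h = f * g := by
  refine HomDescription.eq_of_twistInfl hω hsurj hinj hcentral h (f * g) _ hh fun χ ρ => ?_
  refine (congrArg₂ (· * ·) (hf χ ρ) (hg χ ρ)).trans ?_
  exact (map_mul (TwUnits χ⁻¹) _ _).symm.trans (congrArg (TwUnits χ⁻¹) (brValue_mul x y ρ).symm)

end BrInd

end BrauerIwasawa

end

open BrauerIwasawa in
theorem mainTheorem8 (p : ℕ) [Fact p.Prime]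
    {𝒢 : Type*} [Group 𝒢] [TopologicalSpace 𝒢] [IsTopologicalGroup 𝒢] [CompactSpace 𝒢]
    [T2Space 𝒢] [TotallyDisconnectedSpace 𝒢]
    {Γ : Type*} [CommGroup Γ] [TopologicalSpace Γ] [IsTopologicalGroup Γ] [CompactSpace Γ]
    [T2Space Γ]
    (hΓ : Nonempty (Γ ≃ₜ* Multiplicative ℤ_[p]))
    (ω : 𝒢 →* Γ) (hω : Continuous ω) (hsurj : Function.Surjective ω) (hker : Finite ω.ker)
    (𝒵 : OpenNormalSubgroup 𝒢) (hcentral : 𝒵.toSubgroup ≤ Subgroup.center 𝒢)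
    (h𝒵 : Nonempty (𝒵.toSubgroup ≃ₜ* Multiplicative ℤ_[p])) :
    (∀ ρ : VChar p (𝒢 ⧸ 𝒵.toSubgroup),
      ∃ c : MonPair p (𝒢 ⧸ 𝒵.toSubgroup) →₀ ℤ, Represents c ρ.1) ∧
    ∃! BrInd : InvTuples p 𝒵 →* HomDescription p ω hω,
      ∀ (x : InvTuples p 𝒵) (ρ : VChar p 𝒢) (χ : FinChar p Γ)
        (ρ' : VChar p (𝒢 ⧸ 𝒵.toSubgroup)) (c : MonPair p (𝒢 ⧸ 𝒵.toSubgroup) →₀ ℤ),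
        (∀ g : 𝒢, (VChar.twist (FinChar.infl ω hω χ) ρ).1 g = ρ'.1 (g : 𝒢 ⧸ 𝒵.toSubgroup)) →
        Represents c ρ'.1 →
        (BrInd x).1 (Multiplicative.ofAdd ρ) =
          Units.map (Tw χ⁻¹).toMonoidHom (brProduct ω hω x.1 c) := by
  have hinj : ∀ z ∈ 𝒵.toSubgroup, ω z = 1 → z = 1 := fun z hz h =>
    eq_one_of_map_eq_one hker h𝒵 hz h
  choose B hB using fun x : InvTuples p 𝒵 => exists_brInd hω hsurj hinj hcentral x
  have hprod : ∀ (x : InvTuples p 𝒵) (χ : FinChar p Γ) {ρ : VChar p (𝒢 ⧸ 𝒵.toSubgroup)}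
      {c : MonPair p (𝒢 ⧸ 𝒵.toSubgroup) →₀ ℤ}, Represents c ρ.1 →
      Units.map (Tw χ⁻¹).toMonoidHom (brProduct ω hω x.1 c) = TwUnits χ⁻¹ (brValue ω hω x ρ) :=
    fun x χ _ _ hc => congrArg (TwUnits χ⁻¹) (brProduct_eq_brValue x hc)
  refine ⟨exists_represents, MonoidHom.mk' B fun x y =>
    monoidHom_brInd_mul hω hsurj hinj hcentral x y _ _ _ (hB x) (hB y) (hB (x * y)),
    fun x ρ χ ρ' c h hc => ?_, fun B' hB' => ?_⟩
  · exact (congrArg (fun ρ => (B x).1 (Multiplicative.ofAdd ρ)) (eq_twistInfl h)).trans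
      ((hB x χ ρ').trans (hprod x χ hc).symm)
  -- Uniqueness: since representing tuples exist, the formula prescribes the value on every twisted
  -- inflation, and these generate `R(𝒢)`.
  · refine MonoidHom.ext fun x => HomDescription.eq_of_twistInfl hω hsurj hinj hcentral
      (B' x) (B x) (fun χ ρ => TwUnits χ⁻¹ (brValue ω hω x ρ)) (fun χ ρ => ?_) (hB x)
    have hex : ∃ c : MonPair p (𝒢 ⧸ 𝒵.toSubgroup) →₀ ℤ, Represents c ρ.1 := exists_represents ρ
    obtain ⟨c, hc⟩ := hex
    exact (hB' x (VChar.twistInfl ω hω χ ρ) χ ρ c (twist_twistInfl_apply χ ρ) hc).trans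
      (hprod x χ hc)
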